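/- Let $D\subseteq\mathbb R^d$ be a bounded open set with Lipschitz boundary, i.e. for every $x\in\partial D$ there are, after a suitable rotation of the coordinate axes, numbers $r,h>0$ and a Lipschitz function $\gamma:\mathbb R^{d-1}\to\mathbb R$ such that, writing $y=(y',y_d)$, $$D\cap\{y:\ |y'-x'|<r,\ |y_d-x_d|<h\}=\{y:\ |y'-x'|<r,\ \gamma(y')<y_d<x_d+h\}.$$ Let $V\subseteq\mathbb R^d$ be an open set with $\overline D\subseteq V$, and let $1\le p<\infty$. For open $U\subseteq\mathbb R^d$ let $W^1_p(U)$ be the Sobolev space of all $f\in L^p(U)$ with weak gradient $\nabla f\in L^p(U;\mathbb R^d)$, with norm $\|f\|_{L^p(U)}+\|\nabla f\|_{L^p(U)}$. Then there exists a bounded linear operator $$Q:W^1_p(D)\to W^1_p(\mathbb R^d)$$ such that 1. $Qf=f$ almost everywhere on $D$ for all $f\in W^1_p(D)$; 2. the (essential) support of $Qf$ is contained in $V$ for all $f\in W^1_p(D)$; 3. whenever $f\in W^1_p(D)$ is Hölder continuous on $D$ with exponent $\alpha\in(0,1]$, i.e. after modification on a null set $|f(y)-f(z)|\le C|y-z|^\alpha$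 for all $y,z\in D$ and some constant $C$, then $Qf$ is Hölder continuous on $\mathbb R^d$ with the same exponent: after modification on a null set, $|Qf(y)-Qf(z)|\le C'|y-z|^\alpha$ for all $y,z\in\mathbb R^d$ and some constant $C'$. -/

import Mathlib

open MeasureTheory Set Filter Topology
open scoped NNReal ENNReal ContDiff RealInnerProductSpace

/-- `g` is a weak gradient of `f` in `D`: for every test function `φ ∈ C_c^∞(D)` and every
coordinate direction `i` one has `∫_D f ∂ᵢφ = - ∫_D gᵢ φ`. -/
def IsWeakGradient {d : ℕ} (D : Set (EuclideanSpace ℝ (Fin d)))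
    (f : EuclideanSpace ℝ (Fin d) → ℝ)
    (g : EuclideanSpace ℝ (Fin d) → EuclideanSpace ℝ (Fin d)) : Prop :=
  ∀ φ : EuclideanSpace ℝ (Fin d) → ℝ,
    ContDiff ℝ ∞ φ → HasCompactSupport φ → tsupport φ ⊆ D →
      ∀ i : Fin d,
        ∫ x in D, f x * fderiv ℝ φ x (EuclideanSpace.single i 1) = -∫ x in D, g x i * φ x

theorem integrable_mul_of_memLp_of_test {d : ℕ} {D : Set (EuclideanSpace ℝ (Fin d))} {p : ℝ≥0∞}
    (hp : 1 ≤ p) {f φ : EuclideanSpace ℝ (Fin d) → ℝ} (hf : MemLp f p (volume.restrict D))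
    (hφ : Continuous φ) (hc : HasCompactSupport φ) :
    Integrable (fun x => f x * φ x) (volume.restrict D) := by
  have h := (hf.locallyIntegrable hp).integrable_smul_right_of_hasCompactSupport hφ hc
  simpa [smul_eq_mul] using h

theorem continuous_partial {d : ℕ} {φ : EuclideanSpace ℝ (Fin d) → ℝ}
    (hφ : ContDiff ℝ ∞ φ) (i : Fin d) :
    Continuous (fun x => fderiv ℝ φ x (EuclideanSpace.single i 1)) :=
  (hφ.continuous_fderiv (by simp)).clm_apply continuous_const

theorem hasCompactSupport_partial {d : ℕ} {φ : EuclideanSpace ℝ (Fin d) → ℝ}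
    (hc : HasCompactSupport φ) (i : Fin d) :
    HasCompactSupport (fun x => fderiv ℝ φ x (EuclideanSpace.single i 1)) :=
  hc.fderiv_apply (𝕜 := ℝ) (EuclideanSpace.single i 1)

theorem memLp_coord {d : ℕ} {μ : Measure (EuclideanSpace ℝ (Fin d))} {p : ℝ≥0∞}
    {g : EuclideanSpace ℝ (Fin d) → EuclideanSpace ℝ (Fin d)} (hg : MemLp g p μ) (i : Fin d) :
    MemLp (fun x => g x i) p μ :=
  (EuclideanSpace.proj (𝕜 := ℝ) i).comp_memLp' hg

/-- The pairs `(f, g)` with `f ∈ L^p(D)`, `g ∈ L^p(D; ℝ^d)` and `g` a weak gradient of `f` in `D`,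
with the norm `‖f‖_{L^p} + ‖g‖_{L^p}`. -/
noncomputable def sobolevSubmodule {d : ℕ} (D : Set (EuclideanSpace ℝ (Fin d))) (p : ℝ≥0∞)
    [hp : Fact (1 ≤ p)] :
    Submodule ℝ (WithLp 1 (Lp ℝ p (volume.restrict D) ×
      Lp (EuclideanSpace ℝ (Fin d)) p (volume.restrict D))) where
  carrier := {u | IsWeakGradient D u.fst u.snd}
  zero_mem' := by
    intro φ _ _ _ i
    have h1 : ∀ᵐ x ∂(volume.restrict D), (0 : Lp ℝ p (volume.restrict D)) x = 0 :=
      Lp.coeFn_zero _ _ _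
    have h2 : ∀ᵐ x ∂(volume.restrict D),
        (0 : Lp (EuclideanSpace ℝ (Fin d)) p (volume.restrict D)) x = 0 :=
      Lp.coeFn_zero _ _ _
    simp only [WithLp.zero_fst, WithLp.zero_snd]
    rw [integral_eq_zero_of_ae (by
        filter_upwards [h1] with x hx; simp only [hx, zero_mul, Pi.zero_apply]),
      integral_eq_zero_of_ae (by
        filter_upwards [h2] with x hx; simp only [hx, PiLp.zero_apply, zero_mul, Pi.zero_apply]), neg_zero]
  add_mem' := by
    intro u v hu hv φ hφ hc hs i
    have h1 := hu φ hφ hc hs i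
    have h2 := hv φ hφ hc hs i
    have e1 : ∫ x in D, (u + v).fst x * fderiv ℝ φ x (EuclideanSpace.single i 1)
        = ∫ x in D, (u.fst x * fderiv ℝ φ x (EuclideanSpace.single i 1)
          + v.fst x * fderiv ℝ φ x (EuclideanSpace.single i 1)) := by
      apply integral_congr_ae
      filter_upwards [Lp.coeFn_add u.fst v.fst] with x hx
      rw [WithLp.add_fst, hx, Pi.add_apply, add_mul]
    have e2 : ∫ x in D, (u + v).snd x i * φ x
        = ∫ x in D, (u.snd x i * φ x + v.snd x i * φ x) := by
      apply integral_congr_ae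
      filter_upwards [Lp.coeFn_add u.snd v.snd] with x hx
      rw [WithLp.add_snd, hx, Pi.add_apply, PiLp.add_apply, add_mul]
    rw [e1, e2, integral_add, integral_add, h1, h2, neg_add]
    · exact integrable_mul_of_memLp_of_test hp.out (memLp_coord (Lp.memLp _) i) hφ.continuous hc
    · exact integrable_mul_of_memLp_of_test hp.out (memLp_coord (Lp.memLp _) i) hφ.continuous hc
    · exact integrable_mul_of_memLp_of_test hp.out (Lp.memLp _) (continuous_partial hφ i)
        (hasCompactSupport_partial hc i)
    · exact integrable_mul_of_memLp_of_test hp.out (Lp.memLp _) (continuous_partial hφ i)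
        (hasCompactSupport_partial hc i)
  smul_mem' := by
    intro c u hu φ hφ hc hs i
    have h1 := hu φ hφ hc hs i
    have e1 : ∫ x in D, (c • u).fst x * fderiv ℝ φ x (EuclideanSpace.single i 1)
        = ∫ x in D, c * (u.fst x * fderiv ℝ φ x (EuclideanSpace.single i 1)) := by
      apply integral_congr_ae
      filter_upwards [Lp.coeFn_smul c u.fst] with x hx
      rw [WithLp.smul_fst, hx, Pi.smul_apply, smul_eq_mul, mul_assoc]
    have e2 : ∫ x in D, (c • u).snd x i * φ x = ∫ x in D, c * (u.snd x i * φ x) := by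
      apply integral_congr_ae
      filter_upwards [Lp.coeFn_smul c u.snd] with x hx
      rw [WithLp.smul_snd, hx, Pi.smul_apply, PiLp.smul_apply, smul_eq_mul, mul_assoc]
    rw [e1, e2, integral_const_mul, integral_const_mul, h1, mul_neg]

/-- The Sobolev space `W^1_p(D)`: functions `f ∈ L^p(D)` which have a weak gradient
`∇f ∈ L^p(D; ℝ^d)`. An element is stored as the pair `(f, ∇f)` (for open `D` the weak gradient is
determined by `f`, see `SobolevW1.ext_fn`), so that the norm is `‖f‖_{L^p} + ‖∇f‖_{L^p}`
(see `SobolevW1.norm_eq`). -/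
noncomputable abbrev SobolevW1 {d : ℕ} (D : Set (EuclideanSpace ℝ (Fin d))) (p : ℝ≥0∞)
    [Fact (1 ≤ p)] : Type :=
  sobolevSubmodule D p

namespace SobolevW1

variable {d : ℕ} {D : Set (EuclideanSpace ℝ (Fin d))} {p : ℝ≥0∞} [Fact (1 ≤ p)]

/-- The function `f ∈ L^p(D)` underlying an element of `W^1_p(D)`. -/
noncomputable def fn (u : SobolevW1 D p) : Lp ℝ p (volume.restrict D) :=
  (u : WithLp 1 (Lp ℝ p (volume.restrict D) ×
    Lp (EuclideanSpace ℝ (Fin d)) p (volume.restrict D))).fst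

/-- The weak gradient `∇f ∈ L^p(D; ℝ^d)` of an element of `W^1_p(D)`. -/
noncomputable def grad (u : SobolevW1 D p) :
    Lp (EuclideanSpace ℝ (Fin d)) p (volume.restrict D) :=
  (u : WithLp 1 (Lp ℝ p (volume.restrict D) ×
    Lp (EuclideanSpace ℝ (Fin d)) p (volume.restrict D))).snd

theorem norm_eq (u : SobolevW1 D p) : ‖u‖ = ‖u.fn‖ + ‖u.grad‖ :=
  WithLp.prod_norm_eq_of_L1 _

/-- Every function in `L^p(D)` with a weak gradient in `L^p(D; ℝ^d)` belongs to `W^1_p(D)`. -/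
theorem exists_fn_eq (f : Lp ℝ p (volume.restrict D))
    (g : Lp (EuclideanSpace ℝ (Fin d)) p (volume.restrict D)) (h : IsWeakGradient D f g) :
    ∃ u : SobolevW1 D p, u.fn = f ∧ u.grad = g :=
  ⟨⟨WithLp.toLp 1 (f, g), h⟩, rfl, rfl⟩

/-- On an open set the weak gradient is determined by the function. -/
theorem ext_fn (hD : IsOpen D) {u v : SobolevW1 D p} (h : u.fn = v.fn) : u = v := by
  have hp : (1 : ℝ≥0∞) ≤ p := Fact.out
  have key : ∀ i : Fin d, ∀ᵐ x ∂(volume : Measure (EuclideanSpace ℝ (Fin d))), x ∈ D →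
      u.grad x i - v.grad x i = 0 := by
    intro i
    have hl : ∀ w : SobolevW1 D p, LocallyIntegrableOn (fun x => w.grad x i) D volume := fun w =>
      locallyIntegrableOn_of_locallyIntegrable_restrict
        ((memLp_coord (Lp.memLp w.grad) i).locallyIntegrable hp)
    refine hD.ae_eq_zero_of_integral_contDiff_smul_eq_zero ((hl u).sub (hl v)) ?_
    intro φ hφ hc hs
    have hu : ∫ x in D, u.fn x * fderiv ℝ φ x (EuclideanSpace.single i 1)
        = -∫ x in D, u.grad x i * φ x := u.2 φ hφ hc hs i
    have hv : ∫ x in D, v.fn x * fderiv ℝ φ x (EuclideanSpace.single i 1)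
        = -∫ x in D, v.grad x i * φ x := v.2 φ hφ hc hs i
    rw [h, hv] at hu
    rw [← setIntegral_eq_integral_of_forall_compl_eq_zero (s := D)]
    · have : ∀ x, φ x • (u.grad x i - v.grad x i) = u.grad x i * φ x - v.grad x i * φ x := by
        intro x; rw [smul_eq_mul]; ring
      simp only [this]
      rw [integral_sub, sub_eq_zero]
      · linarith
      · exact integrable_mul_of_memLp_of_test hp (memLp_coord (Lp.memLp _) i) hφ.continuous hc
      · exact integrable_mul_of_memLp_of_test hp (memLp_coord (Lp.memLp _) i) hφ.continuous hc
    · intro x hx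
      rw [image_eq_zero_of_notMem_tsupport (fun hx' => hx (hs hx')), zero_smul]
  have hg : u.grad = v.grad := by
    apply Lp.ext
    rw [EventuallyEq, ae_restrict_iff' hD.measurableSet]
    filter_upwards [ae_all_iff.2 key] with x hx hxD
    ext i
    exact sub_eq_zero.1 (hx i hxD)
  apply Subtype.ext
  apply WithLp.ofLp_injective
  exact Prod.ext h hg

end SobolevW1

/-- `∂D` is Lipschitz: for every `x ∈ ∂D`, in suitable orthonormal coordinates `y = (y', y_d)`,
there are `r, h > 0` and a Lipschitz function `γ : ℝ^{d-1} → ℝ` such that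
`D ∩ {|y' - x'| < r, |y_d - x_d| < h} = {|y' - x'| < r, γ(y') < y_d < x_d + h}`.
The last coordinate axis is spanned by the unit vector `e`, so `y_d = ⟪e, y⟫`, the space of the
`y'` is the hyperplane orthogonal to `e`, and `y'` is the orthogonal projection of `y`. -/
def HasLipschitzBoundary {d : ℕ} (D : Set (EuclideanSpace ℝ (Fin d))) : Prop :=
  ∀ x ∈ frontier D, ∃ e : EuclideanSpace ℝ (Fin d), ‖e‖ = 1 ∧
    ∃ r > (0 : ℝ), ∃ h > (0 : ℝ), ∃ γ : (ℝ ∙ e)ᗮ → ℝ, (∃ K : ℝ≥0, LipschitzWith K γ) ∧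
      D ∩ {y | ‖(ℝ ∙ e)ᗮ.orthogonalProjectionOnto y - (ℝ ∙ e)ᗮ.orthogonalProjectionOnto x‖ < r ∧
          |⟪e, y⟫ - ⟪e, x⟫| < h} =
        {y | ‖(ℝ ∙ e)ᗮ.orthogonalProjectionOnto y - (ℝ ∙ e)ᗮ.orthogonalProjectionOnto x‖ < r ∧
          γ ((ℝ ∙ e)ᗮ.orthogonalProjectionOnto y) < ⟪e, y⟫ ∧ ⟪e, y⟫ < ⟪e, x⟫ + h}

/-- The support of a function on `ℝ^d` defined up to null sets: the complement of the largest
open set on which the function vanishes almost everywhere. -/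
def essSupport {d : ℕ} (f : EuclideanSpace ℝ (Fin d) → ℝ) : Set (EuclideanSpace ℝ (Fin d)) :=
  {x | ∀ U : Set (EuclideanSpace ℝ (Fin d)), IsOpen U → x ∈ U → ¬ f =ᵐ[volume.restrict U] 0}

/-- A function defined up to null sets is Hölder continuous on `D` with exponent `α`: after a
modification on a null set, `|f y - f z| ≤ C |y - z| ^ α` for all `y, z ∈ D`. -/
def IsHolderOn {d : ℕ} (f : EuclideanSpace ℝ (Fin d) → ℝ) (D : Set (EuclideanSpace ℝ (Fin d)))
    (α : ℝ≥0) : Prop :=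
  ∃ f' : EuclideanSpace ℝ (Fin d) → ℝ, f =ᵐ[volume.restrict D] f' ∧
    ∃ C : ℝ≥0, HolderOnWith C α f' D

/-! Near a boundary point $D$ is the region above a Lipschitz graph. Folding the space along that
graph, $T y = y + 2\max(\gamma(y') - y_d, 0)\,e$, gives a Lipschitz map that is the identity on $D$
and sends almost every nearby point into $D$. At interior points $T = \mathrm{id}$ serves.
Compactness of $\overline D$ gives finitely many such charts inside $V$, and with a subordinate
partition of unity $\psi_i$ the extension is $Qf = \sum_i \psi_i\,(f \circ T_i)$.

The main point is that $f \circ T$ has weak gradient $DT^*(\nabla f \circ T)$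
(`IsFoldingChart.isWeakGradient_comp`). Since $T$ is merely Lipschitz and not injective, $f$ is
first mollified by kernels supported in small off-centre balls, pointing so that $T y - z$ stays in
$D$. Rademacher's theorem gives the chain rule for the smooth approximants, and integration by parts
passes to the limit in $L^1$. Limits and norms survive composition with $T$ because $T_*\mathrm{vol}
\le C\,\mathrm{vol}$: $T$ is pointwise either the identity or a Lipschitz involution. Boundedness of
$D$ puts $L^p(D)$ inside $L^1(D)$, so $L^1$ convergence is enough.

For the Hölder claim, $f$ is extended from $D$ to the whole space with the same exponent.
Composition with $T$ and multiplication by $\psi$ keep that exponent. -/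

open scoped Convolution

/-! ### Mollification in $L^1$ and weak gradients -/

section Mollification

variable {E F : Type*} [NormedAddCommGroup E] [InnerProductSpace ℝ E] [FiniteDimensional ℝ E]
  [MeasurableSpace E] [BorelSpace E] [NormedAddCommGroup F]

/-- Translations act continuously on `L^1`. -/
theorem tendsto_lintegral_translate_sub {g : E → F} (hg : Integrable g) :
    Tendsto (fun z : E => ∫⁻ x, ‖g (x - z) - g x‖ₑ) (𝓝 0) (𝓝 0) := by
  have : Fact ((1 : ℝ≥0∞) ≠ ⊤) := ⟨by simp⟩
  let G : Lp F 1 (volume : Measure E) := hg.toL1 g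
  -- Translation is a continuous action on $L^1$; the rest rewrites the $L^1$ distance as an
  -- integral.
  let Φ : E → Lp F 1 (volume : Measure E) := fun z => DomAddAct.mk (-z) +ᵥ G
  have hΦ : Continuous Φ := by
    have h1 : Continuous fun z : E => DomAddAct.mk (-z) :=
      DomAddAct.continuous_mk.comp continuous_neg
    exact h1.vadd continuous_const
  have h0 : Φ 0 = G := by simp [Φ]
  have h1 : Tendsto (fun z => edist (Φ z) G) (𝓝 0) (𝓝 0) := by
    have := (hΦ.tendsto 0)
    rw [h0] at this
    exact tendsto_iff_edist_tendsto_0.1 this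
  refine h1.congr fun z => ?_
  rw [Lp.edist_def, eLpNorm_one_eq_lintegral_enorm]
  apply lintegral_congr_ae
  have e1 := DomAddAct.vadd_Lp_ae_eq (DomAddAct.mk (-z)) G
  have e2 : G =ᵐ[volume] g := hg.coeFn_toL1
  have e3 : (fun x : E => G (-z + x)) =ᵐ[volume] fun x => g (-z + x) :=
    (measurePreserving_add_left volume (-z)).quasiMeasurePreserving.ae_eq_comp e2
  filter_upwards [e1, e2, e3] with x h1 h2 h3
  have h4 : Φ z x = g (x - z) := by
    rw [sub_eq_neg_add, ← h3]; exact h1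
  rw [Pi.sub_apply, h4, h2]

variable [NormedSpace ℝ F]

/-- The mollification of `g` by the kernel `k`. -/
noncomputable def mollify (k : E → ℝ) (g : E → F) (x : E) : F := ∫ t, k (x - t) • g t

theorem mollify_eq_integral_translate (k : E → ℝ) (g : E → F) (x : E) :
    mollify k g x = ∫ z, k z • g (x - z) := by
  rw [mollify, ← integral_sub_left_eq_self (fun z => k z • g (x - z)) volume x]
  simp

theorem mollify_eq_convolution (k f : E → ℝ) :
    mollify k f = f ⋆[ContinuousLinearMap.mul ℝ ℝ, volume] k := by
  ext x
  simp [mollify, convolution_def, mul_comm]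

theorem integrable_mollify_integrand [CompleteSpace F] {k : E → ℝ} {g : E → F} (hk : Continuous k)
    (hkc : HasCompactSupport k) (hg : Integrable g) (x : E) :
    Integrable fun t => k (x - t) • g t := by
  have h1 : Continuous fun t => k (x - t) := hk.comp (continuous_const.sub continuous_id)
  have h2 : HasCompactSupport fun t => k (x - t) :=
    hkc.comp_homeomorph (Homeomorph.subLeft x)
  exact hg.locallyIntegrable.integrable_smul_left_of_hasCompactSupport h1 h2

/-- As $k$ has mass one, the error is an average of translation differences $g(x - z) - g(x)$, and
Tonelli moves the average outside. Nothing requires $k$ to be centred at the origin, which allows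
the shifted kernels used later. -/
theorem lintegral_mollify_sub_le [CompleteSpace F] {k : E → ℝ} {g : E → F} (hk : Continuous k)
    (hkc : HasCompactSupport k) (hk0 : ∀ z, 0 ≤ k z) (hk1 : ∫ z, k z = 1) (hg : Integrable g)
    {a : ℝ≥0∞} (ha : ∀ z ∈ tsupport k, ∫⁻ x, ‖g (x - z) - g x‖ₑ ≤ a) :
    ∫⁻ x, ‖mollify k g x - g x‖ₑ ≤ a := by
  have hki : Integrable k := hk.integrable_of_hasCompactSupport hkc
  have hint : ∀ x, Integrable fun z => k z • g (x - z) := by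
    intro x
    have h := (integrable_mollify_integrand hk hkc hg x).comp_sub_left x
    simpa using h
  have hpt : ∀ x, ‖mollify k g x - g x‖ₑ ≤ ∫⁻ z, ‖k z‖ₑ * ‖g (x - z) - g x‖ₑ := by
    intro x
    have : mollify k g x - g x = ∫ z, k z • (g (x - z) - g x) := by
      simp only [smul_sub]
      rw [integral_sub (hint x) (hki.smul_const _), integral_smul_const, hk1, one_smul,
        mollify_eq_integral_translate]
    rw [this]
    refine (enorm_integral_le_lintegral_enorm _).trans (le_of_eq ?_)
    simp only [enorm_smul]
  have hmeas : AEMeasurable (Function.uncurry fun x z : E => ‖k z‖ₑ * ‖g (x - z) - g x‖ₑ)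
      (volume.prod volume) := by
    have hsub : Measure.QuasiMeasurePreserving (fun q : E × E => q.1 - q.2)
        (volume.prod volume) volume := quasiMeasurePreserving_sub volume volume
    have h1 : AEStronglyMeasurable (fun q : E × E => g (q.1 - q.2)) (volume.prod volume) :=
      hg.aestronglyMeasurable.comp_quasiMeasurePreserving hsub
    have h2 : AEStronglyMeasurable (fun q : E × E => g q.1) (volume.prod volume) :=
      hg.aestronglyMeasurable.comp_fst
    have h3 : AEStronglyMeasurable (fun q : E × E => k q.2) (volume.prod volume) :=
      (hk.comp continuous_snd).aestronglyMeasurable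
    exact h3.enorm.mul (h1.sub h2).enorm
  calc ∫⁻ x, ‖mollify k g x - g x‖ₑ
      ≤ ∫⁻ x, ∫⁻ z, ‖k z‖ₑ * ‖g (x - z) - g x‖ₑ := lintegral_mono hpt
    _ = ∫⁻ z, ∫⁻ x, ‖k z‖ₑ * ‖g (x - z) - g x‖ₑ := lintegral_lintegral_swap hmeas
    _ = ∫⁻ z, ‖k z‖ₑ * ∫⁻ x, ‖g (x - z) - g x‖ₑ := by
        simp_rw [lintegral_const_mul' _ _ enorm_ne_top]
    _ ≤ ∫⁻ z, ‖k z‖ₑ * a := by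
        refine lintegral_mono fun z => ?_
        by_cases hz : z ∈ tsupport k
        · exact mul_le_mul_right (ha z hz) _
        · simp [image_eq_zero_of_notMem_tsupport hz]
    _ = a := by
        rw [lintegral_mul_const'' _ hk.aestronglyMeasurable.enorm,
          ← ofReal_integral_norm_eq_lintegral_enorm hki]
        simp [Real.norm_of_nonneg (hk0 _), hk1]

theorem contDiff_mollify {k f : E → ℝ} (hk : ContDiff ℝ ∞ k) (hkc : HasCompactSupport k)
    (hf : Integrable f) : ContDiff ℝ ∞ (mollify k f) := by
  rw [mollify_eq_convolution]
  exact hkc.contDiff_convolution_right _ hf.locallyIntegrable hk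

theorem hasCompactSupport_mollify {k f : E → ℝ} (hkc : HasCompactSupport k)
    (hfc : HasCompactSupport f) : HasCompactSupport (mollify k f) := by
  rw [mollify_eq_convolution]
  exact hfc.convolution (ContinuousLinearMap.mul ℝ ℝ) hkc

theorem fderiv_mollify {k f : E → ℝ} (hk : ContDiff ℝ ∞ k) (hkc : HasCompactSupport k)
    (hf : Integrable f) (x v : E) :
    fderiv ℝ (mollify k f) x v = ∫ t, f t * fderiv ℝ k (x - t) v := by
  have hk1 : ContDiff ℝ 1 k := hk.of_le (by norm_cast)
  have h2 : ConvolutionExistsAt f (fderiv ℝ k) x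
      (ContinuousLinearMap.precompR E (ContinuousLinearMap.mul ℝ ℝ)) volume :=
    (hkc.fderiv (𝕜 := ℝ)).convolutionExists_right
      (ContinuousLinearMap.precompR E (ContinuousLinearMap.mul ℝ ℝ)) hf.locallyIntegrable
      (hk1.continuous_fderiv (by simp)) x
  have h1 := (hkc.hasFDerivAt_convolution_right (ContinuousLinearMap.mul ℝ ℝ)
    hf.locallyIntegrable hk1 x).fderiv
  rw [mollify_eq_convolution, h1, convolution_def]
  refine (ContinuousLinearMap.integral_apply h2 v).trans ?_
  rfl

end Mollification

/-- Where the kernel only sees points of `D`, the gradient of the mollification is the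
mollification of the weak gradient. -/
theorem IsWeakGradient.fderiv_mollify {d : ℕ} {D : Set (EuclideanSpace ℝ (Fin d))}
    (hD : IsOpen D) {f : EuclideanSpace ℝ (Fin d) → ℝ}
    {g : EuclideanSpace ℝ (Fin d) → EuclideanSpace ℝ (Fin d)} (h : IsWeakGradient D f g)
    (hf : IntegrableOn f D) (hg : IntegrableOn g D) {k : EuclideanSpace ℝ (Fin d) → ℝ}
    (hk : ContDiff ℝ ∞ k) (hkc : HasCompactSupport k) {x : EuclideanSpace ℝ (Fin d)}
    (hx : ∀ z ∈ tsupport k, x - z ∈ D) (v : EuclideanSpace ℝ (Fin d)) :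
    fderiv ℝ (mollify k (D.indicator f)) x v = ⟪mollify k (D.indicator g) x, v⟫ := by
  have hfi : Integrable (D.indicator f) := hf.integrable_indicator hD.measurableSet
  have hgi : Integrable (D.indicator g) := hg.integrable_indicator hD.measurableSet
  have key : ∀ i : Fin d, fderiv ℝ (mollify k (D.indicator f)) x (EuclideanSpace.single i 1)
      = ⟪mollify k (D.indicator g) x, EuclideanSpace.single i 1⟫ := by
    intro i
    -- The reflected kernel is itself an admissible test function, since its support consists of
    -- points $x - z \in D$.
    let φ : EuclideanSpace ℝ (Fin d) → ℝ := fun t => k (x - t)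
    have hφ : ContDiff ℝ ∞ φ := hk.comp (contDiff_const.sub contDiff_id)
    have hφc : HasCompactSupport φ := hkc.comp_homeomorph (Homeomorph.subLeft x)
    have hφs : tsupport φ ⊆ D := by
      intro t ht
      have ht' : x - t ∈ tsupport k := by
        have : tsupport φ ⊆ (fun t => x - t) ⁻¹' tsupport k :=
          tsupport_comp_subset_preimage k (continuous_const.sub continuous_id)
        exact this ht
      simpa using hx _ ht'
    have hφd : ∀ t, fderiv ℝ φ t (EuclideanSpace.single i 1)
        = -fderiv ℝ k (x - t) (EuclideanSpace.single i 1) := by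
      intro t
      have h1 : HasFDerivAt φ ((fderiv ℝ k (x - t)).comp
          (-ContinuousLinearMap.id ℝ (EuclideanSpace ℝ (Fin d)))) t :=
        ((hk.differentiable (by simp)) (x - t)).hasFDerivAt.comp t
          ((hasFDerivAt_id t).const_sub x)
      rw [h1.fderiv]; simp
    have hw := h φ hφ hφc hφs i
    rw [_root_.fderiv_mollify hk hkc hfi]
    have e1 : ∫ t, D.indicator f t * fderiv ℝ k (x - t) (EuclideanSpace.single i 1)
        = -∫ t in D, f t * fderiv ℝ φ t (EuclideanSpace.single i 1) := by
      rw [← integral_indicator hD.measurableSet, ← integral_neg]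
      congr 1; ext t
      by_cases ht : t ∈ D <;> simp [ht, hφd]
    have e2 : ⟪mollify k (D.indicator g) x, EuclideanSpace.single i 1⟫
        = ∫ t in D, g t i * φ t := by
      rw [mollify, real_inner_comm, ← integral_inner
        (integrable_mollify_integrand hk.continuous hkc hgi x),
        ← integral_indicator hD.measurableSet]
      congr 1; ext t
      by_cases ht : t ∈ D
      · simp [ht, φ, EuclideanSpace.inner_single_left, mul_comm]
      · simp [ht]
    rw [e1, e2, hw, neg_neg]
  have hlin : fderiv ℝ (mollify k (D.indicator f)) x
      = innerSL ℝ (mollify k (D.indicator g) x) := by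
    apply ContinuousLinearMap.coe_injective
    refine (EuclideanSpace.basisFun (Fin d) ℝ).toBasis.ext fun i => ?_
    simpa using key i
  rw [hlin]; rfl

/-! ### Composition with maps of bounded pushforward -/

section MapLe

variable {E F : Type*} [NormedAddCommGroup E] [InnerProductSpace ℝ E] [FiniteDimensional ℝ E]
  [MeasurableSpace E] [BorelSpace E] [NormedAddCommGroup F]

theorem aestronglyMeasurable_mollify [NormedSpace ℝ F] {k : E → ℝ} {g : E → F} (hk : Continuous k)
    (hg : AEStronglyMeasurable g) : AEStronglyMeasurable (mollify k g) := by
  have h : AEStronglyMeasurable (fun q : E × E => k (q.1 - q.2) • g q.2)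
      (volume.prod volume) :=
    (hk.comp (continuous_fst.sub continuous_snd)).aestronglyMeasurable.smul hg.comp_snd
  exact h.integral_prod_right'

/-- This stands in for a change of variables, which is unavailable because folding maps are neither
injective nor smooth. -/
theorem lintegral_comp_le_of_map_le {T : E → E} (hT : Continuous T) {C : ℝ≥0}
    (hC : Measure.map T volume ≤ C • (volume : Measure E)) {u : E → ℝ≥0∞}
    (hu : AEMeasurable u) : ∫⁻ y, u (T y) ≤ C * ∫⁻ y, u y := by
  have hu' : AEMeasurable u (Measure.map T volume) :=
    hu.mono_ac (hC.absolutelyContinuous.trans Measure.smul_absolutelyContinuous)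
  rw [← lintegral_map' hu' hT.measurable.aemeasurable]
  refine (lintegral_mono' hC le_rfl).trans (le_of_eq ?_)
  rw [lintegral_smul_measure]; rfl

theorem quasiMeasurePreserving_of_map_le {T : E → E} (hT : Continuous T) {C : ℝ≥0}
    (hC : Measure.map T volume ≤ C • (volume : Measure E)) :
    Measure.QuasiMeasurePreserving T volume volume :=
  ⟨hT.measurable, hC.absolutelyContinuous.trans Measure.smul_absolutelyContinuous⟩

theorem integrable_comp_of_map_le {T : E → E} (hT : Continuous T) {C : ℝ≥0}
    (hC : Measure.map T volume ≤ C • (volume : Measure E)) {u : E → F} (hu : Integrable u) :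
    Integrable (fun y => u (T y)) := by
  refine ⟨hu.1.comp_quasiMeasurePreserving (quasiMeasurePreserving_of_map_le hT hC), ?_⟩
  exact (lintegral_comp_le_of_map_le hT hC hu.1.enorm).trans_lt
    (ENNReal.mul_lt_top ENNReal.coe_lt_top hu.2)

end MapLe

/-! ### Folding charts and the chain rule -/

/-- A chart on `B` for the extension of functions from `D`: a Lipschitz map `T` which is the
identity on `B ∩ D` and maps almost all of `B` into `D`, in such a way that arbitrarily small balls
can be found, all translates of which by `T y`, `y ∈ B`, are contained in `D`. -/
structure IsFoldingChart {d : ℕ} (D B : Set (EuclideanSpace ℝ (Fin d)))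
    (T : EuclideanSpace ℝ (Fin d) → EuclideanSpace ℝ (Fin d)) : Prop where
  isOpen : IsOpen B
  isBounded : Bornology.IsBounded B
  lipschitz : ∃ K : ℝ≥0, LipschitzWith K T
  map_le : ∃ C : ℝ≥0, Measure.map T volume ≤ C • (volume : Measure (EuclideanSpace ℝ (Fin d)))
  eq_self : ∀ y ∈ B, y ∈ D → T y = y
  ae_mem : ∀ᵐ y, y ∈ B → T y ∈ D
  exists_ball : ∀ ε > 0, ∃ (c : EuclideanSpace ℝ (Fin d)) (δ : ℝ), 0 < δ ∧
    Metric.closedBall c δ ⊆ Metric.ball 0 ε ∧ ∀ y ∈ B, ∀ z ∈ Metric.closedBall c δ, T y - z ∈ D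

namespace IsFoldingChart

variable {d : ℕ} {D B : Set (EuclideanSpace ℝ (Fin d))}
  {T : EuclideanSpace ℝ (Fin d) → EuclideanSpace ℝ (Fin d)}

/-- A bump normalised on the off-centre ball of `exists_ball` does both jobs: the ball avoids the
complement of $D$ as seen from $T y$, and it is close enough to the origin that translations by its
points barely move $f$ and $g$ in $L^1$. -/
theorem exists_kernel (hT : IsFoldingChart D B T) {f : EuclideanSpace ℝ (Fin d) → ℝ}
    {g : EuclideanSpace ℝ (Fin d) → EuclideanSpace ℝ (Fin d)} (hf : Integrable f)
    (hg : Integrable g) {a : ℝ≥0∞} (ha : 0 < a) :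
    ∃ k : EuclideanSpace ℝ (Fin d) → ℝ, ContDiff ℝ ∞ k ∧ HasCompactSupport k ∧
      (∀ y ∈ B, ∀ z ∈ tsupport k, T y - z ∈ D) ∧
      ∫⁻ x, ‖mollify k f x - f x‖ₑ ≤ a ∧ ∫⁻ x, ‖mollify k g x - g x‖ₑ ≤ a := by
  have h := ((tendsto_lintegral_translate_sub hf).eventually_le_const ha).and
    ((tendsto_lintegral_translate_sub hg).eventually_le_const ha)
  obtain ⟨ε, hε, hball⟩ := Metric.eventually_nhds_iff_ball.1 h
  obtain ⟨c, δ, hδ, hcε, hcD⟩ := hT.exists_ball ε hε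
  let b : ContDiffBump c := ⟨δ / 2, δ, by positivity, by linarith⟩
  have hs : tsupport (b.normed volume) = Metric.closedBall c δ := b.tsupport_normed_eq
  refine ⟨b.normed volume, b.contDiff_normed, b.hasCompactSupport_normed,
    fun y hy z hz => hcD y hy z (hs ▸ hz), ?_, ?_⟩
  · exact lintegral_mollify_sub_le b.continuous_normed b.hasCompactSupport_normed b.nonneg_normed
      b.integral_normed hf fun z hz => (hball z (hcε (hs ▸ hz))).1
  · exact lintegral_mollify_sub_le b.continuous_normed b.hasCompactSupport_normed b.nonneg_normed
      b.integral_normed hg fun z hz => (hball z (hcε (hs ▸ hz))).2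

/-- The chain rule for the composition of a Sobolev function with a folding map. -/
theorem isWeakGradient_comp (hT : IsFoldingChart D B T) (hD : IsOpen D)
    (hDb : Bornology.IsBounded D) {f : EuclideanSpace ℝ (Fin d) → ℝ}
    {g : EuclideanSpace ℝ (Fin d) → EuclideanSpace ℝ (Fin d)} (h : IsWeakGradient D f g)
    (hf : IntegrableOn f D) (hg : IntegrableOn g D) :
    IsWeakGradient B (fun y => D.indicator f (T y))
      (fun y => (fderiv ℝ T y).adjoint (D.indicator g (T y))) := by
  intro φ hφ hc hs i
  obtain ⟨K, hK⟩ := hT.lipschitz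
  obtain ⟨C, hC⟩ := hT.map_le
  have hfi : Integrable (D.indicator f) := hf.integrable_indicator hD.measurableSet
  have hgi : Integrable (D.indicator g) := hg.integrable_indicator hD.measurableSet
  have hfc : HasCompactSupport (D.indicator f) :=
    HasCompactSupport.of_support_subset_isCompact hDb.isCompact_closure
      (support_indicator_subset.trans subset_closure)
  have hq := quasiMeasurePreserving_of_map_le hK.continuous hC
  obtain ⟨a, -, ha0, ha⟩ := exists_seq_strictAnti_tendsto' (zero_lt_one (α := ℝ≥0∞))
  choose k hk hkc hkD hkf hkg using fun n => hT.exists_kernel hfi hgi (ha0 n).1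
  set e : EuclideanSpace ℝ (Fin d) := EuclideanSpace.single i 1 with he
  have he1 : ‖e‖ = 1 := by simp [he]
  let F : ℕ → EuclideanSpace ℝ (Fin d) → ℝ := fun n => mollify (k n) (D.indicator f)
  have hF : ∀ n, ContDiff ℝ ∞ (F n) := fun n => contDiff_mollify (hk n) (hkc n) hfi
  have hFc : ∀ n, HasCompactSupport (F n) := fun n => hasCompactSupport_mollify (hkc n) hfc
  obtain ⟨M, hM⟩ := hc.exists_bound_of_continuous hφ.continuous
  have hM0 : 0 ≤ M := (norm_nonneg _).trans (hM 0)
  have hφ' : Continuous fun x => fderiv ℝ φ x e := continuous_partial hφ i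
  have hφ'c : HasCompactSupport fun x => fderiv ℝ φ x e := hasCompactSupport_partial hc i
  obtain ⟨M', hM'⟩ := hφ'c.exists_bound_of_continuous hφ'
  have hM'0 : 0 ≤ M' := (norm_nonneg _).trans (hM' 0)
  have hLip : ∀ n, ∃ L, LipschitzWith L (fun y => F n (T y)) := fun n => by
    obtain ⟨L, hL⟩ := (hF n).lipschitzWith_of_hasCompactSupport (hFc n) (by simp)
    exact ⟨_, hL.comp hK⟩
  obtain ⟨Lφ, hLφ⟩ := hφ.lipschitzWith_of_hasCompactSupport hc (by simp)
  -- Integration by parts for Lipschitz functions: $F_n \circ T$ is no smoother than $T$.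
  have hparts : ∀ n, ∫ y, F n (T y) * fderiv ℝ φ y e
      = -∫ y, lineDeriv ℝ (fun y => F n (T y)) y e * φ y := by
    intro n
    obtain ⟨L, hL⟩ := hLip n
    rw [hL.integral_lineDeriv_mul_eq hLφ hc e, ← integral_neg]
    refine integral_congr_ae (.of_forall fun y => ?_)
    simp only
    rw [(hφ.differentiable (by simp) y).lineDeriv_eq_fderiv, map_neg]
    ring
  -- Rademacher is needed only for $T$, as $F_n$ is smooth everywhere. For $y \in B$ the kernel at
  -- $T y$ sees only $D$, so $\nabla F_n(T y)$ is the mollified weak gradient.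
  have hchain : ∀ n, ∀ᵐ y, y ∈ B → lineDeriv ℝ (fun y => F n (T y)) y e
      = ⟪mollify (k n) (D.indicator g) (T y), fderiv ℝ T y e⟫ := by
    intro n
    filter_upwards [hK.ae_differentiableAt (μ := volume)] with y hy hyB
    have hFd : DifferentiableAt ℝ (F n) (T y) := (hF n).differentiable (by simp) _
    have h1 : HasFDerivAt (fun y => F n (T y)) ((fderiv ℝ (F n) (T y)).comp (fderiv ℝ T y)) y :=
      hFd.hasFDerivAt.comp y hy.hasFDerivAt
    rw [h1.differentiableAt.lineDeriv_eq_fderiv, h1.fderiv, ContinuousLinearMap.comp_apply]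
    exact h.fderiv_mollify hD hf hg (hk n) (hkc n) (hkD n y hyB) _
  have hlim0 : ∀ c : ℝ≥0∞, c ≠ ⊤ → Tendsto (fun n => c * a n) atTop (𝓝 0) := fun c hc => by
    simpa using ENNReal.Tendsto.const_mul ha (Or.inr hc)
  have hlim1 : Tendsto (fun n => ∫ y, F n (T y) * fderiv ℝ φ y e) atTop
      (𝓝 (∫ y, D.indicator f (T y) * fderiv ℝ φ y e)) := by
    refine tendsto_integral_of_L1 _ ?_ (.of_forall fun n => ?_) ?_
    · exact (hfi.1.comp_quasiMeasurePreserving hq).mul hφ'.aestronglyMeasurable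
    · exact (((hF n).continuous.comp hK.continuous).mul hφ').integrable_of_hasCompactSupport
        hφ'c.mul_left
    · refine tendsto_of_tendsto_of_tendsto_of_le_of_le tendsto_const_nhds
        (hlim0 (ENNReal.ofReal M' * C) (by finiteness)) (fun _ => zero_le) fun n => ?_
      calc ∫⁻ y, ‖F n (T y) * fderiv ℝ φ y e - D.indicator f (T y) * fderiv ℝ φ y e‖ₑ
          ≤ ∫⁻ y, ENNReal.ofReal M' * ‖F n (T y) - D.indicator f (T y)‖ₑ := by
            refine lintegral_mono fun y => ?_
            rw [← sub_mul, enorm_mul, mul_comm]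
            gcongr
            rw [← ofReal_norm]
            exact ENNReal.ofReal_le_ofReal (hM' y)
        _ = ENNReal.ofReal M' * ∫⁻ y, ‖F n (T y) - D.indicator f (T y)‖ₑ :=
            lintegral_const_mul' _ _ (by finiteness)
        _ ≤ ENNReal.ofReal M' * (C * ∫⁻ y, ‖F n y - D.indicator f y‖ₑ) := by
            gcongr
            exact lintegral_comp_le_of_map_le hK.continuous hC
              (((hF n).continuous.aestronglyMeasurable.sub hfi.1).enorm)
        _ ≤ ENNReal.ofReal M' * (C * a n) := by gcongr; exact hkf n
        _ = ENNReal.ofReal M' * C * a n := (mul_assoc _ _ _).symm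
  have hadj : ∀ y, (fderiv ℝ T y).adjoint (D.indicator g (T y)) i
      = ⟪D.indicator g (T y), fderiv ℝ T y e⟫ := by
    intro y
    rw [← ContinuousLinearMap.adjoint_inner_left, he, EuclideanSpace.inner_single_right]
    simp
  have hmeas : AEStronglyMeasurable (fun y => ⟪D.indicator g (T y), fderiv ℝ T y e⟫) :=
    (hgi.1.comp_quasiMeasurePreserving hq).inner
      (measurable_fderiv_apply_const ℝ T e).aestronglyMeasurable
  -- Off $B$ the factor $\varphi$ vanishes; on $B$, $|DT\,e| \le K$ and $|\varphi| \le M$ produce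
  -- the constant $KM$.
  have hlim2 : Tendsto (fun n => ∫ y, lineDeriv ℝ (fun y => F n (T y)) y e * φ y) atTop
      (𝓝 (∫ y, ⟪D.indicator g (T y), fderiv ℝ T y e⟫ * φ y)) := by
    refine tendsto_integral_of_L1 _ (hmeas.mul hφ.continuous.aestronglyMeasurable)
      (.of_forall fun n => ?_) ?_
    · obtain ⟨L, hL⟩ := hLip n
      exact (hL.locallyIntegrable_lineDeriv e).integrable_smul_right_of_hasCompactSupport
        hφ.continuous hc
    · refine tendsto_of_tendsto_of_tendsto_of_le_of_le tendsto_const_nhds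
        (hlim0 (ENNReal.ofReal (K * M) * C) (by finiteness)) (fun _ => zero_le) fun n => ?_
      calc ∫⁻ y, ‖lineDeriv ℝ (fun y => F n (T y)) y e * φ y
              - ⟪D.indicator g (T y), fderiv ℝ T y e⟫ * φ y‖ₑ
          ≤ ∫⁻ y, ENNReal.ofReal (K * M) *
              ‖mollify (k n) (D.indicator g) (T y) - D.indicator g (T y)‖ₑ := by
            refine lintegral_mono_ae ?_
            filter_upwards [hchain n] with y hy
            by_cases hyB : y ∈ B
            · rw [hy hyB, ← sub_mul, ← inner_sub_left, ← ofReal_norm, ← ofReal_norm,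
                ← ENNReal.ofReal_mul (by positivity), norm_mul]
              apply ENNReal.ofReal_le_ofReal
              calc _ ≤ (‖mollify (k n) (D.indicator g) (T y) - D.indicator g (T y)‖
                    * ‖fderiv ℝ T y e‖) * M := by
                    gcongr
                    · exact norm_inner_le_norm _ _
                    · exact hM y
                _ ≤ (‖mollify (k n) (D.indicator g) (T y) - D.indicator g (T y)‖
                    * K) * M := by
                    gcongr
                    refine ((fderiv ℝ T y).le_opNorm e).trans ?_
                    rw [he1, mul_one]
                    exact norm_fderiv_le_of_lipschitz ℝ hK
                _ = _ := by ring
            · have : φ y = 0 := image_eq_zero_of_notMem_tsupport fun hy' => hyB (hs hy')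
              simp [this]
        _ = ENNReal.ofReal (K * M) *
              ∫⁻ y, ‖mollify (k n) (D.indicator g) (T y) - D.indicator g (T y)‖ₑ :=
            lintegral_const_mul' _ _ (by finiteness)
        _ ≤ ENNReal.ofReal (K * M) *
              (C * ∫⁻ y, ‖mollify (k n) (D.indicator g) y - D.indicator g y‖ₑ) := by
            gcongr
            exact lintegral_comp_le_of_map_le hK.continuous hC
              ((aestronglyMeasurable_mollify (hk n).continuous hgi.1).sub hgi.1).enorm
        _ ≤ ENNReal.ofReal (K * M) * (C * a n) := by gcongr; exact hkg n
        _ = ENNReal.ofReal (K * M) * C * a n := (mul_assoc _ _ _).symm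
  have hfinal := tendsto_nhds_unique hlim1 (by simpa only [hparts] using hlim2.neg)
  simp only [hadj]
  rw [setIntegral_eq_integral_of_forall_compl_eq_zero,
    setIntegral_eq_integral_of_forall_compl_eq_zero]
  · exact hfinal
  · intro y hy
    rw [image_eq_zero_of_notMem_tsupport fun hy' => hy (hs hy'), mul_zero]
  · intro y hy
    rw [image_eq_zero_of_notMem_tsupport
      fun hy' => hy (hs (tsupport_fderiv_apply_subset ℝ e hy')), mul_zero]

end IsFoldingChart

/-! ### Cutting off by a test function -/

/-- The product of a Sobolev function on `B` with a test function on `B` is a Sobolev function on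
the whole space. -/
theorem IsWeakGradient.smooth_mul {d : ℕ} {B : Set (EuclideanSpace ℝ (Fin d))}
    {f ψ : EuclideanSpace ℝ (Fin d) → ℝ}
    {g : EuclideanSpace ℝ (Fin d) → EuclideanSpace ℝ (Fin d)} (h : IsWeakGradient B f g)
    (hf : Integrable f) (hg : Integrable g) (hψ : ContDiff ℝ ∞ ψ) (hψc : HasCompactSupport ψ)
    (hψB : tsupport ψ ⊆ B) :
    IsWeakGradient univ (fun y => ψ y * f y) (fun y => ψ y • g y + f y • gradient ψ y) := by
  intro φ hφ hc _ i
  -- The product $\psi\varphi$ is supported in $B$ even when $\varphi$ is not; its Leibniz term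
  -- becomes the $f\nabla\psi$ part of the gradient.
  have hprod := h (fun y => ψ y * φ y) (hψ.mul hφ) hψc.mul_right
    ((tsupport_mul_subset_left (f := ψ) (g := φ)).trans hψB) i
  have hd : ∀ y, fderiv ℝ (fun y => ψ y * φ y) y (EuclideanSpace.single i 1)
      = ψ y * fderiv ℝ φ y (EuclideanSpace.single i 1)
        + φ y * fderiv ℝ ψ y (EuclideanSpace.single i 1) := by
    intro y
    rw [fderiv_fun_mul (hψ.differentiable (by simp) y) (hφ.differentiable (by simp) y)]
    simp
  have hgrad : ∀ y, gradient ψ y i = fderiv ℝ ψ y (EuclideanSpace.single i 1) := by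
    intro y
    rw [← InnerProductSpace.toDual_symm_apply (𝕜 := ℝ) (y := fderiv ℝ ψ y),
      EuclideanSpace.inner_single_right]
    simp [gradient]
  rw [setIntegral_eq_integral_of_forall_compl_eq_zero,
    setIntegral_eq_integral_of_forall_compl_eq_zero] at hprod
  · have hfi : ∀ u : EuclideanSpace ℝ (Fin d) → ℝ, Continuous u → HasCompactSupport u →
        Integrable fun y => f y * u y := fun u hu huc =>
      hf.locallyIntegrable.integrable_smul_right_of_hasCompactSupport hu huc
    have hgi : Integrable fun y => g y i * (ψ y * φ y) :=
      (memLp_one_iff_integrable.1 (memLp_coord (memLp_one_iff_integrable.2 hg) i))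
        |>.locallyIntegrable.integrable_smul_right_of_hasCompactSupport
        (hψ.continuous.mul hφ.continuous) hψc.mul_right
    have i1 := hfi (fun y => ψ y * fderiv ℝ φ y (EuclideanSpace.single i 1))
      (hψ.continuous.mul (continuous_partial hφ i)) hψc.mul_right
    have i2 := hfi (fun y => φ y * fderiv ℝ ψ y (EuclideanSpace.single i 1))
      (hφ.continuous.mul (continuous_partial hψ i)) hc.mul_right
    simp only [hd, mul_add] at hprod
    rw [integral_add i1 i2] at hprod
    simp only [Measure.restrict_univ, PiLp.add_apply, PiLp.smul_apply, smul_eq_mul, hgrad]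
    have e1 : ∫ y, ψ y * f y * fderiv ℝ φ y (EuclideanSpace.single i 1)
        = ∫ y, f y * (ψ y * fderiv ℝ φ y (EuclideanSpace.single i 1)) := by
      congr 1; ext y; ring
    have e2 : ∫ y, (ψ y * g y i + f y * fderiv ℝ ψ y (EuclideanSpace.single i 1)) * φ y
        = ∫ y, (g y i * (ψ y * φ y) + f y * (φ y * fderiv ℝ ψ y (EuclideanSpace.single i 1))) := by
      congr 1; ext y; ring
    rw [e1, e2, integral_add hgi i2]
    linarith
  · intro y hy
    rw [image_eq_zero_of_notMem_tsupport fun hy' => hy (hψB hy'), zero_mul, mul_zero]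
  · intro y hy
    rw [hd, image_eq_zero_of_notMem_tsupport fun hy' => hy (hψB hy'),
      image_eq_zero_of_notMem_tsupport
        fun hy' => hy (hψB (tsupport_fderiv_apply_subset ℝ _ hy')), zero_mul, mul_zero, add_zero,
      mul_zero]

/-! ### Pushforward of volume under reflections -/

section Reflection

variable {E : Type*} [NormedAddCommGroup E] [InnerProductSpace ℝ E] [FiniteDimensional ℝ E]
  [MeasurableSpace E] [BorelSpace E]

/-- For an involution preimages are images, and a $K$-Lipschitz map enlarges $n$-dimensional
Hausdorff measure, a multiple of which is the volume, by at most $K^n$. -/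
theorem map_le_of_lipschitzWith_of_involutive {R : E → E} {K : ℝ≥0} (hR : LipschitzWith K R)
    (hinv : Function.Involutive R) :
    ∃ C : ℝ≥0, Measure.map R volume ≤ C • (volume : Measure E) := by
  have hvol : (volume : Measure E) = Measure.addHaarScalarFactor volume
      (Measure.hausdorffMeasure (Module.finrank ℝ E) : Measure E) •
        (Measure.hausdorffMeasure (Module.finrank ℝ E) : Measure E) :=
    Measure.isAddLeftInvariant_eq_smul _ _
  refine ⟨K ^ Module.finrank ℝ E, Measure.le_iff.2 fun s hs => ?_⟩
  rw [Measure.map_apply hR.continuous.measurable hs, ← hinv.image_eq_preimage_symm]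
  have h := hR.hausdorffMeasure_image_le (d := Module.finrank ℝ E) (by positivity) s
  rw [hvol]
  simp only [Measure.smul_apply, ENNReal.smul_def, smul_eq_mul]
  refine (mul_le_mul_right h _).trans (le_of_eq ?_)
  rw [ENNReal.rpow_natCast, ENNReal.coe_pow]
  ring

/-- Every preimage satisfies $T^{-1}(s) \subseteq s \cup R^{-1}(s)$. -/
theorem map_le_of_forall_eq_or_eq {T R : E → E} {C : ℝ≥0} (hT : Continuous T)
    (hR : Continuous R) (hC : Measure.map R volume ≤ C • (volume : Measure E))
    (h : ∀ y, T y = y ∨ T y = R y) :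
    Measure.map T volume ≤ (1 + C) • (volume : Measure E) := by
  refine Measure.le_iff.2 fun s hs => ?_
  have h1 : T ⁻¹' s ⊆ s ∪ R ⁻¹' s := by
    intro y hy
    rcases h y with h | h
    · exact Or.inl (h ▸ hy)
    · exact Or.inr (by rw [mem_preimage, ← h]; exact hy)
  rw [Measure.map_apply hT.measurable hs, add_smul, one_smul]
  refine (measure_mono h1).trans ((measure_union_le _ _).trans ?_)
  rw [Measure.add_apply, ← Measure.map_apply hR.measurable hs]
  gcongr

end Reflection

/-! ### The fold along a Lipschitz graph -/

section Fold

variable {E : Type*} [NormedAddCommGroup E] [InnerProductSpace ℝ E]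

/-- The signed height of the graph of `γ` above `y`, in the direction `e`. -/
noncomputable def graphDepth (e : E) (γ : (ℝ ∙ e)ᗮ → ℝ) (y : E) : ℝ :=
  γ ((ℝ ∙ e)ᗮ.orthogonalProjectionOnto y) - ⟪e, y⟫

/-- The reflection in the graph of `γ`, in the direction `e`. -/
noncomputable def graphReflection (e : E) (γ : (ℝ ∙ e)ᗮ → ℝ) (y : E) : E :=
  y + graphDepth e γ y • (2 : ℝ) • e

/-- The map that reflects the points below the graph of `γ` and fixes the points above it. -/
noncomputable def graphFold (e : E) (γ : (ℝ ∙ e)ᗮ → ℝ) (y : E) : E :=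
  y + max (graphDepth e γ y) 0 • (2 : ℝ) • e

variable {e : E} {γ : (ℝ ∙ e)ᗮ → ℝ} {K : ℝ≥0}

theorem orthogonalProjectionOnto_add_smul_self (y : E) (t : ℝ) :
    (ℝ ∙ e)ᗮ.orthogonalProjectionOnto (y + t • e) = (ℝ ∙ e)ᗮ.orthogonalProjectionOnto y := by
  rw [map_add, map_smul, Submodule.orthogonalProjectionOnto_orthogonalComplement_singleton_eq_zero,
    smul_zero, add_zero]

theorem inner_add_smul_self (he : ‖e‖ = 1) (y : E) (t : ℝ) : ⟪e, y + t • e⟫ = ⟪e, y⟫ + t := by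
  rw [inner_add_right, inner_smul_right, real_inner_self_eq_norm_sq, he]
  ring

theorem graphDepth_add_smul_self (he : ‖e‖ = 1) (y : E) (t : ℝ) :
    graphDepth e γ (y + t • e) = graphDepth e γ y - t := by
  rw [graphDepth, graphDepth, orthogonalProjectionOnto_add_smul_self, inner_add_smul_self he]
  ring

theorem orthogonalProjectionOnto_graphFold (y : E) :
    (ℝ ∙ e)ᗮ.orthogonalProjectionOnto (graphFold e γ y)
      = (ℝ ∙ e)ᗮ.orthogonalProjectionOnto y := by
  rw [graphFold, smul_smul, orthogonalProjectionOnto_add_smul_self]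

/-- Moving by $t$ along $e$ lowers the depth by $t$, so moving by twice a positive depth flips its
sign. Hence folded points lie above the graph, strictly unless they started on it. -/
theorem graphDepth_graphFold (he : ‖e‖ = 1) (y : E) :
    graphDepth e γ (graphFold e γ y) = -|graphDepth e γ y| := by
  rw [graphFold, smul_smul, graphDepth_add_smul_self he]
  rcases le_total (graphDepth e γ y) 0 with h | h
  · rw [max_eq_right h, abs_of_nonpos h]; ring
  · rw [max_eq_left h, abs_of_nonneg h]; ring

theorem graphReflection_involutive (he : ‖e‖ = 1) :
    Function.Involutive (graphReflection e γ) := by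
  intro y
  have h : graphDepth e γ (graphReflection e γ y) = -graphDepth e γ y := by
    rw [graphReflection, smul_smul, graphDepth_add_smul_self he]; ring
  rw [graphReflection, h, graphReflection, neg_smul, add_neg_cancel_right]

theorem exists_lipschitzWith_graphDepth (hγ : LipschitzWith K γ) :
    ∃ L, LipschitzWith L (graphDepth e γ) :=
  ⟨_, (hγ.comp ((ℝ ∙ e)ᗮ.orthogonalProjectionOnto).lipschitz).sub (innerSL ℝ e).lipschitz⟩

theorem exists_lipschitzWith_graphReflection (hγ : LipschitzWith K γ) :
    ∃ L, LipschitzWith L (graphReflection e γ) := by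
  obtain ⟨L, hL⟩ := exists_lipschitzWith_graphDepth hγ
  exact ⟨_, LipschitzWith.id.add
    ((ContinuousLinearMap.toSpanSingleton ℝ ((2 : ℝ) • e)).lipschitz.comp hL)⟩

theorem exists_lipschitzWith_graphFold (hγ : LipschitzWith K γ) :
    ∃ L, LipschitzWith L (graphFold e γ) := by
  obtain ⟨L, hL⟩ := exists_lipschitzWith_graphDepth hγ
  exact ⟨_, LipschitzWith.id.add
    ((ContinuousLinearMap.toSpanSingleton ℝ ((2 : ℝ) • e)).lipschitz.comp (hL.max_const 0))⟩

theorem graphFold_eq_self {y : E} (hy : graphDepth e γ y ≤ 0) : graphFold e γ y = y := by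
  rw [graphFold, max_eq_right hy, zero_smul, add_zero]

theorem graphFold_eq_self_or_graphReflection (y : E) :
    graphFold e γ y = y ∨ graphFold e γ y = graphReflection e γ y := by
  rcases le_total (graphDepth e γ y) 0 with h | h
  · exact Or.inl (graphFold_eq_self h)
  · exact Or.inr (by rw [graphFold, graphReflection, max_eq_left h])

variable [FiniteDimensional ℝ E] [MeasurableSpace E] [BorelSpace E]

/-- The translates of the graph by $2^{-n} e$ are pairwise disjoint and the translation vectors are
bounded, which forces measure zero. -/
theorem volume_graphDepth_eq_zero (he : ‖e‖ = 1) (hγ : LipschitzWith K γ) :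
    volume {y | graphDepth e γ y = 0} = 0 := by
  obtain ⟨L, hL⟩ := exists_lipschitzWith_graphDepth hγ
  have hlim : Tendsto (fun n : ℕ => ((1 / 2 : ℝ) ^ n) • e) atTop (𝓝 ((0 : ℝ) • e)) :=
    (tendsto_pow_atTop_nhds_zero_of_lt_one (by norm_num) (by norm_num)).smul_const e
  refine Measure.addHaar_eq_zero_of_disjoint_translates volume _
    (Metric.isBounded_range_of_tendsto _ hlim) (fun m n hmn => ?_)
    (isClosed_eq hL.continuous continuous_const).measurableSet
  simp only [Function.onFun, image_add_left, singleton_add, disjoint_left, mem_preimage]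
  intro y hym hyn
  have h : ∀ j : ℕ, -((1 / 2 : ℝ) ^ j • e) + y ∈ {y | graphDepth e γ y = 0} →
      graphDepth e γ y = -(1 / 2 : ℝ) ^ j := by
    intro j hj
    rw [← neg_smul, add_comm, mem_ofPred_eq, graphDepth_add_smul_self he] at hj
    linarith
  have heq : (1 / 2 : ℝ) ^ m = (1 / 2 : ℝ) ^ n := by linarith [h m hym, h n hyn]
  exact hmn ((pow_right_strictAnti₀ (by norm_num) (by norm_num)).injective heq)

theorem exists_map_graphFold_le (he : ‖e‖ = 1) (hγ : LipschitzWith K γ) :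
    ∃ C : ℝ≥0, Measure.map (graphFold e γ) volume ≤ C • (volume : Measure E) := by
  obtain ⟨L, hL⟩ := exists_lipschitzWith_graphFold hγ
  obtain ⟨L', hL'⟩ := exists_lipschitzWith_graphReflection hγ
  obtain ⟨C, hC⟩ := map_le_of_lipschitzWith_of_involutive hL' (graphReflection_involutive he)
  exact ⟨_, map_le_of_forall_eq_or_eq hL.continuous hL'.continuous hC
    graphFold_eq_self_or_graphReflection⟩

end Fold

/-! ### Charts at interior and boundary points -/

section ChartConstruction

variable {d : ℕ} {D V : Set (EuclideanSpace ℝ (Fin d))}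

theorem exists_isFoldingChart_of_mem (hD : IsOpen D) (hDV : closure D ⊆ V)
    {x : EuclideanSpace ℝ (Fin d)} (hx : x ∈ D) :
    ∃ B T, x ∈ B ∧ B ⊆ V ∧ IsFoldingChart D B T := by
  obtain ⟨ρ, hρ, hball⟩ := Metric.isOpen_iff.1 hD x hx
  have hsub : Metric.ball x (ρ / 2) ⊆ D :=
    (Metric.ball_subset_ball (by linarith)).trans hball
  refine ⟨Metric.ball x (ρ / 2), id, Metric.mem_ball_self (by positivity),
    hsub.trans (subset_closure.trans hDV), Metric.isOpen_ball, Metric.isBounded_ball,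
    ⟨1, LipschitzWith.id⟩, ⟨1, by simp⟩, fun _ _ _ => rfl, .of_forall fun y hy => hsub hy, ?_⟩
  intro ε hε
  refine ⟨0, min (ε / 2) (ρ / 2), by positivity, ?_, ?_⟩
  · exact Metric.closedBall_subset_ball ((min_le_left _ _).trans_lt (by linarith))
  · intro y hy z hz
    apply hball
    rw [Metric.mem_ball, dist_eq_norm] at hy ⊢
    rw [mem_closedBall_zero_iff] at hz
    calc ‖id y - z - x‖ = ‖(y - x) - z‖ := by congr 1; simp only [id]; abel
      _ ≤ ‖y - x‖ + ‖z‖ := norm_sub_le _ _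
      _ < ρ := by linarith [hz.trans (min_le_right _ _)]

theorem exists_isFoldingChart_of_mem_frontier (hD : IsOpen D) (hDL : HasLipschitzBoundary D)
    (hV : IsOpen V) (hDV : closure D ⊆ V) {x : EuclideanSpace ℝ (Fin d)} (hx : x ∈ frontier D) :
    ∃ B T, x ∈ B ∧ B ⊆ V ∧ IsFoldingChart D B T := by
  obtain ⟨e, he, r, hr, h, hh, γ, ⟨K, hγ⟩, heq⟩ := hDL x hx
  set P : EuclideanSpace ℝ (Fin d) →L[ℝ] (ℝ ∙ e)ᗮ := (ℝ ∙ e)ᗮ.orthogonalProjectionOnto with hP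
  obtain ⟨L, hL⟩ := exists_lipschitzWith_graphFold (e := e) hγ
  obtain ⟨L', hL'⟩ := exists_lipschitzWith_graphDepth (e := e) hγ
  have hPn : ∀ y, ‖P y‖ ≤ ‖y‖ := fun y => Submodule.norm_orthogonalProjectionOnto_apply_le _ y
  have hen : ∀ y, |⟪e, y⟫| ≤ ‖y‖ := fun y => by
    simpa [he] using abs_real_inner_le_norm e y
  have hmem : ∀ y, ‖P y - P x‖ < r → graphDepth e γ y < 0 → ⟪e, y⟫ < ⟪e, x⟫ + h → y ∈ D := by
    intro y h1 h2 h3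
    exact ((Set.ext_iff.1 heq y).2 ⟨h1, by rw [graphDepth] at h2; linarith, h3⟩).1
  have hneg : ∀ y ∈ D, ‖P y - P x‖ < r → |⟪e, y⟫ - ⟪e, x⟫| < h → graphDepth e γ y < 0 := by
    intro y h1 h2 h3
    have := ((Set.ext_iff.1 heq y).1 ⟨h1, h2, h3⟩).2.1
    rw [graphDepth]; linarith
  have hxD : x ∉ D := by rw [hD.frontier_eq] at hx; exact hx.2
  -- Negative depth would put $x$ in the open set $D$; positive depth is excluded because $x$ is a
  -- limit of points of $D$, which have negative depth near $x$.
  have hx0 : graphDepth e γ x = 0 := by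
    refine le_antisymm ?_ (not_lt.1 fun hlt => hxD (hmem x (by simpa using hr) hlt (by linarith)))
    have hxc : x ∈ closure D := frontier_subset_closure hx
    have hcyl : {y | ‖P y - P x‖ < r ∧ |⟪e, y⟫ - ⟪e, x⟫| < h} ∈ 𝓝 x := by
      refine IsOpen.mem_nhds (IsOpen.and ?_ ?_) ⟨by simpa using hr, by simpa using hh⟩
      · exact isOpen_lt (by fun_prop) continuous_const
      · exact isOpen_lt (by fun_prop) continuous_const
    have hfreq : ∃ᶠ y in 𝓝 x, graphDepth e γ y ≤ 0 :=
      ((mem_closure_iff_frequently.1 hxc).and_eventually hcyl).mono fun y hy =>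
        (hneg y hy.1 hy.2.1 hy.2.2).le
    have hcl : IsClosed {y | graphDepth e γ y ≤ 0} :=
      isClosed_le hL'.continuous continuous_const
    exact hcl.mem_of_frequently_of_tendsto hfreq tendsto_id
  have hxx : graphFold e γ x = x := graphFold_eq_self hx0.le
  -- The halves $r/2$ and $h/2$ leave room to perturb the folded point inside the cylinder. The last
  -- condition stops folding from crossing its top, and the unit ball makes $B$ bounded.
  let B : Set (EuclideanSpace ℝ (Fin d)) := V ∩ Metric.ball x 1 ∩
    {y | ‖P y - P x‖ < r / 2 ∧ |⟪e, y⟫ - ⟪e, x⟫| < h ∧ ⟪e, graphFold e γ y⟫ < ⟪e, x⟫ + h / 2}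
  have hB : IsOpen B := by
    refine (hV.inter Metric.isOpen_ball).inter (IsOpen.and ?_ (IsOpen.and ?_ ?_))
    · exact isOpen_lt (by fun_prop) continuous_const
    · exact isOpen_lt (by fun_prop) continuous_const
    · exact isOpen_lt (continuous_const.inner hL.continuous) continuous_const
  have hPT : ∀ y, P (graphFold e γ y) = P y := fun y => orthogonalProjectionOnto_graphFold y
  refine ⟨B, graphFold e γ, ?_, fun y hy => hy.1.1, hB,
    Metric.isBounded_ball.subset fun y hy => hy.1.2, ⟨L, hL⟩, exists_map_graphFold_le he hγ,
    ?_, ?_, ?_⟩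
  · refine ⟨⟨hDV (frontier_subset_closure hx), Metric.mem_ball_self one_pos⟩,
      by simpa using hr, by simpa using hh, ?_⟩
    rw [hxx]; linarith
  · intro y hy hyD
    exact graphFold_eq_self (hneg y hyD (hy.2.1.trans (by linarith)) hy.2.2.1).le
  -- Points on the graph are fixed by the fold and so need not enter $D$; they form a null set.
  · have hnull : ∀ᵐ y, graphDepth e γ y ≠ 0 := by
      rw [ae_iff]; simpa using volume_graphDepth_eq_zero he hγ
    filter_upwards [hnull] with y hy0 hy
    refine hmem _ ?_ ?_ (hy.2.2.2.trans (by linarith))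
    · rw [hPT]; exact hy.2.1.trans (by linarith)
    · rw [graphDepth_graphFold he]
      exact neg_neg_of_pos (abs_pos.2 hy0)
  · intro ε hε
    -- the ball is centred at `-s • e` and has radius `s / (2 * (K + 1))`
    obtain ⟨s, hs0, hsε, hsr, hsh⟩ : ∃ s > 0, 2 * s < ε ∧ 2 * s < r ∧ 4 * s < h := by
      refine ⟨min (ε / 4) (min (r / 4) (h / 8)), by positivity, ?_, ?_, ?_⟩
      · linarith [min_le_left (ε / 4) (min (r / 4) (h / 8))]
      · linarith [min_le_right (ε / 4) (min (r / 4) (h / 8)), min_le_left (r / 4) (h / 8)]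
      · linarith [min_le_right (ε / 4) (min (r / 4) (h / 8)), min_le_right (r / 4) (h / 8)]
    have hK1 : (0 : ℝ) < K + 1 := by positivity
    set δ : ℝ := s / (2 * (K + 1)) with hδ
    have hδ0 : 0 < δ := by positivity
    have hδK : (K + 1) * δ = s / 2 := by rw [hδ]; field_simp
    have hδs : δ ≤ s / 2 := by nlinarith [K.coe_nonneg]
    refine ⟨(-s) • e, δ, hδ0, ?_, ?_⟩
    · intro z hz
      rw [Metric.mem_closedBall, dist_eq_norm] at hz
      rw [mem_ball_zero_iff]
      calc ‖z‖ = ‖(z - (-s) • e) + (-s) • e‖ := by rw [sub_add_cancel]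
        _ ≤ ‖z - (-s) • e‖ + ‖(-s) • e‖ := norm_add_le _ _
        _ ≤ δ + s := by
            rw [norm_smul, he, mul_one, norm_neg, Real.norm_of_nonneg hs0.le]
            gcongr
        _ < ε := by linarith
    · intro y hy z hz
      rw [Metric.mem_closedBall, dist_eq_norm] at hz
      -- Subtracting $z = w - s e$ means a raise by $s$ and a shift by $-w$ with $\|w\| \le \delta$.
      -- The shift costs at most $(K + 1)\delta = s/2$ in depth, so the point ends strictly above
      -- the graph.
      set w := z - (-s) • e with hw
      have hsplit : graphFold e γ y - z = (graphFold e γ y - w) + s • e := by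
        rw [hw, neg_smul]; abel
      have hdepth : graphDepth e γ (graphFold e γ y - w) ≤ s / 2 := by
        have h1 : γ (P (graphFold e γ y - w)) ≤ γ (P (graphFold e γ y)) + K * δ := by
          have := hγ.dist_le_mul (P (graphFold e γ y - w)) (P (graphFold e γ y))
          rw [Real.dist_eq, dist_eq_norm, ← map_sub, sub_sub_cancel_left, map_neg,
            norm_neg] at this
          have h2 : K * ‖P w‖ ≤ K * δ := by gcongr; exact (hPn w).trans hz
          linarith [le_abs_self (γ (P (graphFold e γ y - w)) - γ (P (graphFold e γ y)))]
        have h3 : graphDepth e γ (graphFold e γ y) ≤ 0 := by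
          rw [graphDepth_graphFold he]; exact neg_nonpos.2 (abs_nonneg _)
        rw [graphDepth, ← hP] at h3 ⊢
        rw [inner_sub_right]
        linarith [le_abs_self ⟪e, w⟫, hen w, hz]
      rw [hsplit]
      refine hmem _ ?_ ?_ ?_
      · rw [hP, orthogonalProjectionOnto_add_smul_self, ← hP, map_sub, hPT]
        calc ‖P y - P w - P x‖ = ‖(P y - P x) - P w‖ := by congr 1; abel
          _ ≤ ‖P y - P x‖ + ‖P w‖ := norm_sub_le _ _
          _ < r := by linarith [hy.2.1, (hPn w).trans hz]
      · rw [graphDepth_add_smul_self he]; linarith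
      · rw [inner_add_smul_self he, inner_sub_right]
        linarith [hy.2.2.2, neg_abs_le ⟪e, w⟫, hen w, hz]

theorem exists_isFoldingChart (hD : IsOpen D) (hDL : HasLipschitzBoundary D) (hV : IsOpen V)
    (hDV : closure D ⊆ V) {x : EuclideanSpace ℝ (Fin d)} (hx : x ∈ closure D) :
    ∃ B T, x ∈ B ∧ B ⊆ V ∧ IsFoldingChart D B T := by
  by_cases hxD : x ∈ D
  · exact exists_isFoldingChart_of_mem hD hDV hxD
  · exact exists_isFoldingChart_of_mem_frontier hD hDL hV hDV
      (by rw [hD.frontier_eq]; exact ⟨hx, hxD⟩)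

end ChartConstruction

/-! ### Hölder extension and products -/

section Holder

variable {X : Type*} [PseudoMetricSpace X]

/-- A real-valued Hölder function on a subset extends to a Hölder function on the whole space, with
the same constant and exponent. -/
theorem HolderOnWith.extend_real {C α : ℝ≥0} (hα0 : 0 < α) (hα1 : α ≤ 1) {f : X → ℝ} {s : Set X}
    (hf : HolderOnWith C α f s) : ∃ g : X → ℝ, HolderWith C α g ∧ EqOn f g s := by
  -- For the metric $d^\alpha$, Hölder functions are Lipschitz, and real Lipschitz functions extend
  -- with the same constant.
  let S := Metric.Snowflaking X α (by exact_mod_cast hα0) (by exact_mod_cast hα1)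
  let ι : X ≃ S := Metric.Snowflaking.toSnowflaking
  have hS : LipschitzOnWith C (f ∘ ι.symm) (ι '' s) := by
    rintro _ ⟨x, hx, rfl⟩ _ ⟨y, hy, rfl⟩
    rw [Metric.Snowflaking.edist_toSnowflaking_toSnowflaking]
    simpa using hf x hx y hy
  obtain ⟨g, hg, hfg⟩ := hS.extend_real
  refine ⟨g ∘ ι, fun x y => ?_, fun x hx => ?_⟩
  · have := hg (ι x) (ι y)
    rwa [Metric.Snowflaking.edist_toSnowflaking_toSnowflaking] at this
  · simpa using hfg (mem_image_of_mem ι hx)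

/-- The product of a Hölder function with a compactly supported Lipschitz function is a Hölder
function. -/
theorem HolderWith.exists_mul_of_hasCompactSupport {C L α : ℝ≥0} (hα0 : 0 < α) (hα1 : α ≤ 1)
    {f ψ : X → ℝ} (hf : HolderWith C α f) (hψ : LipschitzWith L ψ) (hψc : HasCompactSupport ψ) :
    ∃ C' : ℝ≥0, HolderWith C' α (fun x => ψ x * f x) := by
  obtain ⟨M, hM⟩ := hψc.exists_bound_of_continuous hψ.continuous
  obtain ⟨N, hN⟩ := hψc.isCompact.exists_bound_of_continuousOn (hf.continuous hα0).continuousOn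
  -- Boundedness is the Hölder condition of exponent 0; interpolating with the Lipschitz condition,
  -- exponent 1, yields exponent $\alpha$.
  have hψ0 : HolderWith (2 * M.toNNReal) 0 ψ := by
    intro x y
    rw [edist_dist, NNReal.coe_zero, ENNReal.rpow_zero, mul_one]
    refine ENNReal.ofReal_le_coe.2 ?_
    rw [dist_eq_norm, NNReal.coe_mul, NNReal.coe_ofNat]
    have hM0 := Real.le_coe_toNNReal M
    linarith [norm_sub_le (ψ x) (ψ y), hM x, hM y]
  have hψα := hψ0.of_le_of_le (holderWith_one.2 hψ) hα0.le hα1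
  set C₁ := max (2 * M.toNNReal) L
  have hN0 := Real.le_coe_toNNReal N
  have hM0 := Real.le_coe_toNNReal M
  -- the estimate when the second factor is evaluated at a point of the support
  have key : ∀ x y, x ∈ tsupport ψ → dist (ψ x * f x) (ψ y * f y)
      ≤ (C₁ * N.toNNReal + M.toNNReal * C : ℝ≥0) * dist x y ^ (α : ℝ) := by
    intro x y hx
    have h1 := hψα.dist_le x y
    have h2 := hf.dist_le x y
    rw [Real.dist_eq] at h1 h2 ⊢
    have h3 : |f x| ≤ N.toNNReal := (hN x hx).trans hN0
    have h4 : |ψ y| ≤ M.toNNReal := (hM y).trans hM0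
    calc |ψ x * f x - ψ y * f y| = |(ψ x - ψ y) * f x + ψ y * (f x - f y)| := by congr 1; ring
      _ ≤ |ψ x - ψ y| * |f x| + |ψ y| * |f x - f y| := by
          rw [← abs_mul, ← abs_mul]; exact abs_add_le _ _
      _ ≤ (C₁ * dist x y ^ (α : ℝ)) * N.toNNReal
          + M.toNNReal * (C * dist x y ^ (α : ℝ)) := by gcongr
      _ = _ := by push_cast; ring
  have hdist : ∀ x y, dist (ψ x * f x) (ψ y * f y)
      ≤ (C₁ * N.toNNReal + M.toNNReal * C : ℝ≥0) * dist x y ^ (α : ℝ) := by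
    intro x y
    by_cases hx : x ∈ tsupport ψ
    · exact key x y hx
    by_cases hy : y ∈ tsupport ψ
    · rw [dist_comm, dist_comm x y]
      exact key y x hy
    · rw [image_eq_zero_of_notMem_tsupport hx, image_eq_zero_of_notMem_tsupport hy]
      simp only [zero_mul, dist_self]
      positivity
  refine ⟨C₁ * N.toNNReal + M.toNNReal * C, fun x y => ?_⟩
  rw [edist_dist, edist_dist, ENNReal.ofReal_rpow_of_nonneg dist_nonneg α.coe_nonneg,
    ← ENNReal.ofReal_coe_nnreal, ← ENNReal.ofReal_mul (NNReal.coe_nonneg _)]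
  exact ENNReal.ofReal_le_ofReal (hdist x y)

end Holder

/-! ### The local extension operators -/

theorem ae_restrict_univ_iff {X : Type*} [MeasureSpace X] {P : X → Prop} :
    (∀ᵐ y ∂volume.restrict univ, P y) ↔ ∀ᵐ y, P y := by
  rw [Measure.restrict_univ]

theorem eLpNorm_comp_le_of_map_le {E F : Type*} [NormedAddCommGroup E] [InnerProductSpace ℝ E]
    [FiniteDimensional ℝ E] [MeasurableSpace E] [BorelSpace E] [NormedAddCommGroup F] {T : E → E}
    (hT : Continuous T) {C : ℝ≥0} (hC : Measure.map T volume ≤ C • (volume : Measure E))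
    {p : ℝ≥0∞} (hp : p ≠ ⊤) {u : E → F} (hu : AEStronglyMeasurable u) :
    eLpNorm (fun y => u (T y)) p ≤ (C ^ p.toReal⁻¹ : ℝ≥0) * eLpNorm u p := by
  have hu' : AEStronglyMeasurable u (Measure.map T volume) :=
    hu.mono_ac (hC.absolutelyContinuous.trans Measure.smul_absolutelyContinuous)
  have h1 := eLpNorm_map_measure (p := p) hu' hT.measurable.aemeasurable
  have h2 := eLpNorm_mono_measure (p := p) u hC
  rw [h1, eLpNorm_smul_measure_of_ne_top' hp, ENNReal.smul_def, smul_eq_mul] at h2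
  exact h2

theorem aestronglyMeasurable_adjoint_apply {d : ℕ} {μ : Measure (EuclideanSpace ℝ (Fin d))}
    {A : EuclideanSpace ℝ (Fin d) → EuclideanSpace ℝ (Fin d) →L[ℝ] EuclideanSpace ℝ (Fin d)}
    {g : EuclideanSpace ℝ (Fin d) → EuclideanSpace ℝ (Fin d)} (hA : AEStronglyMeasurable A μ)
    (hg : AEStronglyMeasurable g μ) : AEStronglyMeasurable (fun y => (A y).adjoint (g y)) μ := by
  have h1 : AEStronglyMeasurable (fun y => (A y).adjoint) μ :=
    (LinearIsometryEquiv.continuous ContinuousLinearMap.adjoint).comp_aestronglyMeasurable hA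
  exact isBoundedBilinearMap_apply.continuous.comp_aestronglyMeasurable (h1.prodMk hg)

namespace IsFoldingChart

variable {d : ℕ} {D B : Set (EuclideanSpace ℝ (Fin d))}
  {T : EuclideanSpace ℝ (Fin d) → EuclideanSpace ℝ (Fin d)} {p : ℝ≥0∞} [Fact (1 ≤ p)]
  {ψ : EuclideanSpace ℝ (Fin d) → ℝ}

/-- The gradient $\psi\,DT^*(\nabla u \circ T) + (u \circ T)\nabla\psi$ is identified in $L^1$; its
$L^p$ bound follows from the bounds on $\psi$, $\nabla\psi$, $DT$ and the pushforward. The constant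
does not depend on $u$. -/
theorem exists_extension (hT : IsFoldingChart D B T) (hD : IsOpen D)
    (hDb : Bornology.IsBounded D) (hp : p ≠ ⊤) (hψ : ContDiff ℝ ∞ ψ)
    (hψc : HasCompactSupport ψ) (hψB : tsupport ψ ⊆ B) :
    ∃ A : ℝ, ∀ u : SobolevW1 D p,
      ∃ v : SobolevW1 (univ : Set (EuclideanSpace ℝ (Fin d))) p,
        v.fn =ᵐ[volume] (fun y => ψ y * D.indicator u.fn (T y)) ∧ ‖v‖ ≤ A * ‖u‖ := by
  have hp1 : 1 ≤ p := Fact.out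
  obtain ⟨K, hK⟩ := hT.lipschitz
  obtain ⟨C, hC⟩ := hT.map_le
  have hq := quasiMeasurePreserving_of_map_le hK.continuous hC
  obtain ⟨M, hM⟩ := hψc.exists_bound_of_continuous hψ.continuous
  have hM0 : 0 ≤ M := (norm_nonneg _).trans (hM 0)
  have hψ' : Continuous (gradient ψ) :=
    (InnerProductSpace.toDual ℝ _).symm.continuous.comp (hψ.continuous_fderiv (by simp))
  have hψ'c : HasCompactSupport (gradient ψ) :=
    (hψc.fderiv (𝕜 := ℝ)).comp_left (map_zero (InnerProductSpace.toDual ℝ _).symm)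
  obtain ⟨M', hM'⟩ := hψ'c.exists_bound_of_continuous hψ'
  have hM'0 : 0 ≤ M' := (norm_nonneg _).trans (hM' 0)
  have hDfin : IsFiniteMeasure (volume.restrict D) := by
    constructor
    rw [Measure.restrict_apply_univ]
    exact hDb.measure_lt_top
  set c : ℝ≥0 := C ^ p.toReal⁻¹ with hc
  refine ⟨M * (c : ℝ) + (M * K * (c : ℝ) + M' * (c : ℝ)), fun u => ?_⟩
  have hf : MemLp u.fn p (volume.restrict D) := Lp.memLp _
  have hg : MemLp u.grad p (volume.restrict D) := Lp.memLp _
  have hfI : MemLp (D.indicator u.fn) p := (memLp_indicator_iff_restrict hD.measurableSet).2 hf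
  have hgI : MemLp (D.indicator u.grad) p := (memLp_indicator_iff_restrict hD.measurableSet).2 hg
  have hf1 : IntegrableOn u.fn D := hf.integrable hp1
  have hg1 : IntegrableOn u.grad D := hg.integrable hp1
  let F : EuclideanSpace ℝ (Fin d) → ℝ := fun y => D.indicator u.fn (T y)
  let G : EuclideanSpace ℝ (Fin d) → EuclideanSpace ℝ (Fin d) :=
    fun y => (fderiv ℝ T y).adjoint (D.indicator u.grad (T y))
  have hnf : eLpNorm F p ≤ c * ENNReal.ofReal ‖u.fn‖ := by
    refine (eLpNorm_comp_le_of_map_le hK.continuous hC hp hfI.1).trans (le_of_eq ?_)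
    rw [eLpNorm_indicator_eq_eLpNorm_restrict hD.measurableSet, Lp.norm_def,
      ENNReal.ofReal_toReal hf.2.ne]
  have hng : eLpNorm (fun y => D.indicator u.grad (T y)) p ≤ c * ENNReal.ofReal ‖u.grad‖ := by
    refine (eLpNorm_comp_le_of_map_le hK.continuous hC hp hgI.1).trans (le_of_eq ?_)
    rw [eLpNorm_indicator_eq_eLpNorm_restrict hD.measurableSet, Lp.norm_def,
      ENNReal.ofReal_toReal hg.2.ne]
  have hGle : ∀ y, ‖G y‖ ≤ K * ‖D.indicator u.grad (T y)‖ := fun y => by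
    refine (ContinuousLinearMap.le_opNorm _ _).trans ?_
    rw [LinearIsometryEquiv.norm_map]
    gcongr
    exact norm_fderiv_le_of_lipschitz ℝ hK
  have hGmeas : AEStronglyMeasurable G :=
    aestronglyMeasurable_adjoint_apply (measurable_fderiv ℝ T).aestronglyMeasurable
      (hgI.1.comp_quasiMeasurePreserving hq)
  have hF1 : Integrable F := integrable_comp_of_map_le hK.continuous hC
    (hf1.integrable_indicator hD.measurableSet)
  have hG1 : Integrable G :=
    ((integrable_comp_of_map_le hK.continuous hC
      (hg1.integrable_indicator hD.measurableSet)).norm.const_mul (K : ℝ)).mono' hGmeas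
      (.of_forall hGle)
  have hw : IsWeakGradient univ (fun y => ψ y * F y) (fun y => ψ y • G y + F y • gradient ψ y) :=
    (hT.isWeakGradient_comp hD hDb u.2 hf1 hg1).smooth_mul hF1 hG1 hψ hψc hψB
  have hb1 : eLpNorm (fun y => ψ y * F y) p
      ≤ ENNReal.ofReal M * (c * ENNReal.ofReal ‖u.fn‖) := by
    refine (eLpNorm_le_mul_eLpNorm_of_ae_le_mul (g := F) (c := M) (.of_forall fun y => ?_) p).trans
      (by gcongr)
    rw [norm_mul]
    gcongr
    exact hM y
  have hb2 : eLpNorm (fun y => ψ y • G y) p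
      ≤ ENNReal.ofReal (M * K) * (c * ENNReal.ofReal ‖u.grad‖) := by
    refine (eLpNorm_le_mul_eLpNorm_of_ae_le_mul (g := fun y => D.indicator u.grad (T y))
      (c := M * K) (.of_forall fun y => ?_) p).trans (by gcongr)
    rw [norm_smul, mul_assoc]
    gcongr
    · exact hM y
    · exact hGle y
  have hb3 : eLpNorm (fun y => F y • gradient ψ y) p
      ≤ ENNReal.ofReal M' * (c * ENNReal.ofReal ‖u.fn‖) := by
    refine (eLpNorm_le_mul_eLpNorm_of_ae_le_mul (g := F) (c := M') (.of_forall fun y => ?_)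
      p).trans (by gcongr)
    rw [norm_smul, mul_comm]
    gcongr
    exact hM' y
  have hm1 : MemLp (fun y => ψ y * F y) p :=
    ⟨hψ.continuous.aestronglyMeasurable.mul hF1.1, hb1.trans_lt (by finiteness)⟩
  have hm2 : MemLp (fun y => ψ y • G y) p :=
    ⟨hψ.continuous.aestronglyMeasurable.smul hG1.1, hb2.trans_lt (by finiteness)⟩
  have hm3 : MemLp (fun y => F y • gradient ψ y) p :=
    ⟨hF1.1.smul hψ'.aestronglyMeasurable, hb3.trans_lt (by finiteness)⟩
  have hm4 : MemLp (fun y => ψ y • G y + F y • gradient ψ y) p := hm2.add hm3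
  rw [← Measure.restrict_univ (μ := volume)] at hm1 hm4
  have hae1 := hm1.coeFn_toLp
  have hae4 := hm4.coeFn_toLp
  obtain ⟨v, hv1, hv2⟩ := SobolevW1.exists_fn_eq (hm1.toLp _) (hm4.toLp _) (by
    intro φ hφ hφc hs i
    have e1 : ∫ y in univ, (hm1.toLp _ : _ → ℝ) y * fderiv ℝ φ y (EuclideanSpace.single i 1)
        = ∫ y in univ, ψ y * F y * fderiv ℝ φ y (EuclideanSpace.single i 1) :=
      integral_congr_ae (hae1.mono fun y hy => by simp only [hy])
    have e2 : ∫ y in univ, (hm4.toLp _ : _ → EuclideanSpace ℝ (Fin d)) y i * φ y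
        = ∫ y in univ, (ψ y • G y + F y • gradient ψ y) i * φ y :=
      integral_congr_ae (hae4.mono fun y hy => by simp only [hy])
    rw [e1, e2]
    exact hw φ hφ hφc hs i)
  refine ⟨v, ?_, ?_⟩
  · rw [hv1]
    exact ae_restrict_univ_iff.1 hae1
  · rw [SobolevW1.norm_eq, SobolevW1.norm_eq, hv1, hv2, Lp.norm_toLp, Lp.norm_toLp,
      Measure.restrict_univ]
    have h1 : (eLpNorm (fun y => ψ y * F y) p).toReal ≤ M * ((c : ℝ) * ‖u.fn‖) := by
      refine (ENNReal.toReal_mono (by finiteness) hb1).trans (le_of_eq ?_)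
      simp [ENNReal.toReal_ofReal hM0]
    have h2 : (eLpNorm (fun y => ψ y • G y + F y • gradient ψ y) p).toReal
        ≤ M * K * ((c : ℝ) * ‖u.grad‖) + M' * ((c : ℝ) * ‖u.fn‖) := by
      refine (ENNReal.toReal_mono (by finiteness)
        ((eLpNorm_add_le hm2.1 hm3.1 hp1).trans (add_le_add hb2 hb3))).trans (le_of_eq ?_)
      rw [ENNReal.toReal_add (by finiteness) (by finiteness)]
      simp [ENNReal.toReal_ofReal (mul_nonneg hM0 K.coe_nonneg), ENNReal.toReal_ofReal hM'0]
    refine (add_le_add h1 h2).trans ?_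
    have n1 := norm_nonneg u.fn
    have n2 := norm_nonneg u.grad
    have c0 := c.coe_nonneg
    have k0 := K.coe_nonneg
    -- These are the cross terms of $A\,(\|u\|_{L^p} + \|\nabla u\|_{L^p})$ that the estimate does
    -- not use.
    have t1 : 0 ≤ M * (c : ℝ) * ‖u.grad‖ := by positivity
    have t2 : 0 ≤ M * K * (c : ℝ) * ‖u.fn‖ := by positivity
    have t3 : 0 ≤ M' * (c : ℝ) * ‖u.grad‖ := by positivity
    linarith

/-- The local extension operator `u ↦ ψ · (u ∘ T)`. -/
theorem exists_extensionOperator (hT : IsFoldingChart D B T) (hD : IsOpen D)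
    (hDb : Bornology.IsBounded D) (hp : p ≠ ⊤) (hψ : ContDiff ℝ ∞ ψ)
    (hψc : HasCompactSupport ψ) (hψB : tsupport ψ ⊆ B) :
    ∃ Q : SobolevW1 D p →L[ℝ] SobolevW1 (univ : Set (EuclideanSpace ℝ (Fin d))) p,
      ∀ u, (Q u).fn =ᵐ[volume] fun y => ψ y * D.indicator u.fn (T y) := by
  obtain ⟨A, hA⟩ := hT.exists_extension hD hDb hp hψ hψc hψB
  choose v hv hvA using hA
  obtain ⟨K, hK⟩ := hT.lipschitz
  obtain ⟨C, hC⟩ := hT.map_le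
  have hq := quasiMeasurePreserving_of_map_le hK.continuous hC
  have hpull : ∀ {w w' : EuclideanSpace ℝ (Fin d) → ℝ}, w =ᵐ[volume.restrict D] w' →
      ∀ᵐ y, D.indicator w (T y) = D.indicator w' (T y) := fun {w w'} h =>
    hq.ae (p := fun y => D.indicator w y = D.indicator w' y)
      (((ae_restrict_iff' hD.measurableSet).1 h).mono fun y hy => by
      by_cases hyD : y ∈ D
      · simp [hyD, hy hyD]
      · simp [hyD])
  -- The values `v u` were merely chosen, but uniqueness of weak gradients lets the almost
  -- everywhere formula determine them, and that formula is linear in `u`.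
  have hext : ∀ u u' : SobolevW1 (univ : Set (EuclideanSpace ℝ (Fin d))) p,
      u.fn =ᵐ[volume] u'.fn → u = u' := fun u u' h =>
    SobolevW1.ext_fn isOpen_univ (Lp.ext (ae_restrict_univ_iff.2 h))
  let Ql : SobolevW1 D p →ₗ[ℝ] SobolevW1 (univ : Set (EuclideanSpace ℝ (Fin d))) p :=
    { toFun := v
      map_add' := fun u w => by
        apply hext
        have h1 : (v u + v w).fn =ᵐ[volume] (v u).fn + (v w).fn := 
          ae_restrict_univ_iff.1 (Lp.coeFn_add (v u).fn (v w).fn)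
        filter_upwards [hv (u + w), hv u, hv w, h1, hpull (Lp.coeFn_add u.fn w.fn)]
          with y h1 h2 h3 h4 h5
        have h5' : D.indicator (u + w).fn (T y) = _ := h5
        rw [h1, h4, Pi.add_apply, h2, h3, h5', indicator_add', Pi.add_apply, mul_add]
      map_smul' := fun a u => by
        apply hext
        have h1 : (a • v u).fn =ᵐ[volume] a • (v u).fn := 
          ae_restrict_univ_iff.1 (Lp.coeFn_smul a (v u).fn)
        filter_upwards [hv (a • u), hv u, h1, hpull (Lp.coeFn_smul a u.fn)] with y h1 h2 h3 h4
        have h4' : D.indicator (a • u).fn (T y) = _ := h4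
        rw [RingHom.id_apply, h1, h3, Pi.smul_apply, h2, h4', smul_eq_mul, mul_left_comm]
        by_cases hy : T y ∈ D <;> simp [hy] }
  exact ⟨Ql.mkContinuous A hvA, hv⟩

end IsFoldingChart

/-- The composition of a Hölder function with a folding map, multiplied by a test function, is
Hölder continuous on the whole space. -/
theorem IsFoldingChart.exists_holderWith {d : ℕ} {D B : Set (EuclideanSpace ℝ (Fin d))}
    {T : EuclideanSpace ℝ (Fin d) → EuclideanSpace ℝ (Fin d)} (hT : IsFoldingChart D B T)
    {f ψ : EuclideanSpace ℝ (Fin d) → ℝ} (hψ : ContDiff ℝ ∞ ψ) (hψc : HasCompactSupport ψ)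
    (hψB : tsupport ψ ⊆ B) {α : ℝ≥0} (hα0 : 0 < α) (hα1 : α ≤ 1) (hf : IsHolderOn f D α)
    (hD : IsOpen D) :
    ∃ (h : EuclideanSpace ℝ (Fin d) → ℝ) (C : ℝ≥0), HolderWith C α h ∧
      (fun y => ψ y * D.indicator f (T y)) =ᵐ[volume] h := by
  obtain ⟨f', hff', C, hC⟩ := hf
  -- Outside $B$ the map $T$ may leave $D$, so a globally Hölder function is needed before
  -- composing. On the support of $\psi$ the two compositions agree almost everywhere.
  obtain ⟨g, hg, hfg⟩ := hC.extend_real hα0 hα1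
  obtain ⟨K, hK⟩ := hT.lipschitz
  obtain ⟨C₁, hC₁⟩ := hT.map_le
  obtain ⟨L, hL⟩ := hψ.lipschitzWith_of_hasCompactSupport hψc (by simp)
  have hgT := hg.comp (holderWith_one.2 hK)
  rw [mul_one] at hgT
  obtain ⟨C', hC'⟩ := hgT.exists_mul_of_hasCompactSupport hα0 hα1 hL hψc
  refine ⟨_, C', hC', ?_⟩
  have hpull : ∀ᵐ y, T y ∈ D → f (T y) = f' (T y) :=
    (quasiMeasurePreserving_of_map_le hK.continuous hC₁).ae (p := fun y => y ∈ D → f y = f' y)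
      ((ae_restrict_iff' hD.measurableSet).1 hff')
  filter_upwards [hpull, hT.ae_mem] with y h1 h2
  by_cases hy : y ∈ tsupport ψ
  · have hyD := h2 (hψB hy)
    rw [indicator_of_mem hyD, h1 hyD, hfg hyD, Function.comp_apply]
  · rw [image_eq_zero_of_notMem_tsupport hy, zero_mul, zero_mul]

/-! ### Gluing by a partition of unity -/

theorem exists_holderWith_sum {X ι : Type*} [PseudoMetricSpace X] (s : Finset ι) {α : ℝ≥0}
    {h : ι → X → ℝ} (hh : ∀ i ∈ s, ∃ C, HolderWith C α (h i)) :
    ∃ C, HolderWith C α (fun x => ∑ i ∈ s, h i x) := by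
  classical
  induction s using Finset.induction_on with
  | empty => exact ⟨0, by simp⟩
  | insert i s his ih =>
    obtain ⟨C, hC⟩ := ih fun j hj => hh j (Finset.mem_insert_of_mem hj)
    obtain ⟨C', hC'⟩ := hh i (Finset.mem_insert_self i s)
    refine ⟨C' + C, ?_⟩
    simp only [Finset.sum_insert his]
    exact hC'.add hC

/-- Finitely many folding charts contained in `V`, with a subordinate smooth partition of unity. -/
theorem exists_foldingChart_partition {d : ℕ} {D V : Set (EuclideanSpace ℝ (Fin d))}
    (hD : IsOpen D) (hDb : Bornology.IsBounded D) (hDL : HasLipschitzBoundary D)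
    (hV : IsOpen V) (hDV : closure D ⊆ V) :
    ∃ (ι : Type) (_ : Fintype ι) (B : ι → Set (EuclideanSpace ℝ (Fin d)))
      (T : ι → EuclideanSpace ℝ (Fin d) → EuclideanSpace ℝ (Fin d))
      (ψ : ι → EuclideanSpace ℝ (Fin d) → ℝ),
      (∀ i, B i ⊆ V) ∧ (∀ i, IsFoldingChart D (B i) (T i)) ∧ (∀ i, ContDiff ℝ ∞ (ψ i)) ∧
      (∀ i, HasCompactSupport (ψ i)) ∧ (∀ i, tsupport (ψ i) ⊆ B i) ∧
      ∀ y ∈ D, ∑ i, ψ i y = 1 := by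
  choose! B T hxB hBV hT using fun x (hx : x ∈ closure D) =>
    exists_isFoldingChart hD hDL hV hDV hx
  obtain ⟨t, ht⟩ := hDb.isCompact_closure.elim_finite_subcover
    (fun x : closure D => B x) (fun x => (hT x x.2).isOpen)
    fun x hx => mem_iUnion.2 ⟨⟨x, hx⟩, hxB x hx⟩
  obtain ⟨ρ, hρ⟩ := SmoothPartitionOfUnity.exists_isSubordinate
    (modelWithCornersSelf ℝ (EuclideanSpace ℝ (Fin d))) isClosed_closure
    (fun i : t => B i) (fun i => (hT i i.1.2).isOpen) (fun x hx => by
      obtain ⟨i, hi, hx⟩ := mem_iUnion₂.1 (ht hx)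
      exact mem_iUnion.2 ⟨⟨i, hi⟩, hx⟩)
  refine ⟨t, inferInstance, fun i => B i, fun i => T i, fun i => ρ i, fun i => hBV i i.1.2,
    fun i => hT i i.1.2, fun i => (ρ i).contMDiff.contDiff, fun i => ?_, hρ, fun y hy => ?_⟩
  · exact (Metric.isCompact_of_isClosed_isBounded (isClosed_tsupport _)
      ((hT i i.1.2).isBounded.subset (hρ i)))
  · rw [← finsum_eq_sum_of_fintype]
    exact ρ.sum_eq_one (subset_closure hy)

theorem proposition6p1 (d : ℕ) (D V : Set (EuclideanSpace ℝ (Fin d)))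
    (hD : IsOpen D) (hDb : Bornology.IsBounded D) (hDL : HasLipschitzBoundary D)
    (hV : IsOpen V) (hDV : closure D ⊆ V)
    (p : ℝ≥0∞) [Fact (1 ≤ p)] (hp : p ≠ ⊤) :
    ∃ Q : SobolevW1 D p →L[ℝ] SobolevW1 (Set.univ : Set (EuclideanSpace ℝ (Fin d))) p,
      (∀ f : SobolevW1 D p, (Q f).fn =ᵐ[volume.restrict D] f.fn) ∧
      (∀ f : SobolevW1 D p, essSupport (Q f).fn ⊆ V) ∧
      (∀ f : SobolevW1 D p, ∀ α : ℝ≥0, 0 < α → α ≤ 1 →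
        IsHolderOn f.fn D α → IsHolderOn (Q f).fn Set.univ α) := by
  obtain ⟨ι, _, B, T, ψ, hBV, hT, hψ, hψc, hψB, hψ1⟩ :=
    exists_foldingChart_partition hD hDb hDL hV hDV
  choose Q hQ using fun i =>
    (hT i).exists_extensionOperator (p := p) hD hDb hp (hψ i) (hψc i) (hψB i)
  have hsum : ∀ (s : Finset ι) (u : SobolevW1 D p), ((∑ i ∈ s, Q i) u).fn =ᵐ[volume]
      fun y => ∑ i ∈ s, ψ i y * D.indicator u.fn (T i y) := by
    classical
    intro s u
    induction s using Finset.induction_on with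
    | empty =>
      simp only [Finset.sum_empty]
      exact ae_restrict_univ_iff.1 (Lp.coeFn_zero ℝ p (volume.restrict univ))
    | insert i s his ih =>
      rw [Finset.sum_insert his]
      have h1 : ((Q i + ∑ j ∈ s, Q j) u).fn =ᵐ[volume]
          fun y => (Q i u).fn y + ((∑ j ∈ s, Q j) u).fn y :=
        ae_restrict_univ_iff.1 (Lp.coeFn_add (Q i u).fn ((∑ j ∈ s, Q j) u).fn)
      filter_upwards [h1, hQ i u, ih] with y h1 h2 h3
      rw [h1, h2, h3, Finset.sum_insert his]
  refine ⟨∑ i, Q i, fun u => ?_, fun u x hx => ?_, fun u α hα0 hα1 hu => ?_⟩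
  · refine (ae_restrict_iff' hD.measurableSet).2 ?_
    filter_upwards [hsum Finset.univ u] with y hy hyD
    rw [hy]
    -- On $D$ each fold is the identity wherever its cutoff is nonzero, so the sum collapses by
    -- $\sum_i \psi_i = 1$.
    calc ∑ i, ψ i y * D.indicator u.fn (T i y) = ∑ i, ψ i y * u.fn y := by
          refine Finset.sum_congr rfl fun i _ => ?_
          by_cases hyi : y ∈ tsupport (ψ i)
          · rw [(hT i).eq_self y (hψB i hyi) hyD, indicator_of_mem hyD]
          · rw [image_eq_zero_of_notMem_tsupport hyi, zero_mul, zero_mul]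
      _ = u.fn y := by rw [← Finset.sum_mul, hψ1 y hyD, one_mul]
  · by_contra hxV
    have hcl : IsClosed (⋃ i, tsupport (ψ i)) :=
      isClosed_iUnion_of_finite fun i => isClosed_tsupport _
    -- Finitely many supports have a closed union inside $V$; off it $Qu$ vanishes almost
    -- everywhere.
    refine hx (⋃ i, tsupport (ψ i))ᶜ hcl.isOpen_compl ?_ ?_
    · intro hx'
      obtain ⟨i, hi⟩ := mem_iUnion.1 hx'
      exact hxV (hBV i (hψB i hi))
    · refine (ae_restrict_iff' hcl.isOpen_compl.measurableSet).2 ?_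
      filter_upwards [hsum Finset.univ u] with y hy hyU
      rw [hy]
      refine Finset.sum_eq_zero fun i _ => ?_
      rw [image_eq_zero_of_notMem_tsupport fun hi => hyU (mem_iUnion.2 ⟨i, hi⟩), zero_mul]
  · choose h C hh hhae using fun i =>
      (hT i).exists_holderWith (hψ i) (hψc i) (hψB i) hα0 hα1 hu hD
    obtain ⟨C', hC'⟩ := exists_holderWith_sum Finset.univ fun i _ => ⟨C i, hh i⟩
    refine ⟨_, ae_restrict_univ_iff.2 ?_, C', hC'.holderOnWith univ⟩
    filter_upwards [hsum Finset.univ u, ae_all_iff.2 hhae] with y h1 h2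
    rw [h1]
    exact Finset.sum_congr rfl fun i _ => h2 i
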